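/- Let $\mathbb{T}_d$ be the rooted $d$-regular tree, and let $X=(X(v))_{v\in\mathbb{T}_d}$ be a random labelling, that is, the labels $X(v)$ are independent and uniform on $[0,1]$. A graph automorphism $\varphi$ acts on labellings by $(\varphi\cdot x)(v)=x(\varphi^{-1}(v))$. A factor is a measurable function $f:[0,1]^{\mathbb{T}_d}\to\{0,1\}$ that is invariant under all automorphisms of $\mathbb{T}_d$ fixing the root. It generates the random set $I$ of vertices in which $v\in I$ if and only if $f(\varphi_v\cdot X)=1$, where $\varphi_v$ is any automorphism mapping $v$ to the root. If $I$ is an independent set with probability $1$, it is called a factor of i.i.d. independent set; its density is $\mathrm{density}(I)=\mathbb{P}(\mathrm{root}\in I)$. For $d\ge 2$ define $\alpha_d$ by $$\alpha_d\,\frac{\log d}{d}=\sup\{\mathrm{density}(I): I\text{ is a factor of i.i.d. independent set in }\mathbb{T}_d\}.$$ **Theorem.** $\limsup_{d\to\infty}\alpha_d\le 1$. In other words, for every $\varepsilon>0$ there is a $D$ such that for all $d>D$ every factor of i.i.d. independent set in $\mathbb{T}_d$ has density at most $(1+\varepsilon)\frac{\log d}{d}$. This bound is asymptotically sharp: $\alpha_d\to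 1$ as $d\to\infty$. -/

import Mathlib

open MeasureTheory Filter Topology

/-- The vertices of the `d`-regular tree: words in `d` letters in which consecutive letters are
distinct.  The empty word has `d` one-letter extensions on the left; any other word has `d - 1`
of them, and one parent (its tail). -/
abbrev TreeVertex (d : ℕ) : Type := {w : List (Fin d) // w.IsChain (· ≠ ·)}

/-- The rooted `d`-regular tree `𝕋_d`: a word is joined to its tail. -/
def regularTree (d : ℕ) : SimpleGraph (TreeVertex d) where
  Adj u v := (∃ a, v.1 = a :: u.1) ∨ (∃ a, u.1 = a :: v.1)
  symm := ⟨fun _ _ h => h.symm⟩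
  loopless := ⟨fun u h => by
    rcases h with ⟨a, h⟩ | ⟨a, h⟩ <;> simpa using congrArg List.length h⟩

/-- The root of `𝕋_d`. -/
def treeRoot (d : ℕ) : TreeVertex d := ⟨[], List.IsChain.nil⟩

/-- Labellings of `𝕋_d` by elements of `[0, 1]`. -/
abbrev TreeLabelling (d : ℕ) : Type := TreeVertex d → unitInterval

/-- The law of the random labelling of `𝕋_d`: independent uniform labels. -/
noncomputable def labelMeasure (d : ℕ) : Measure (TreeLabelling d) :=
  Measure.infinitePi fun _ => (volume : Measure unitInterval)

/-- The action of graph automorphisms on labellings: `(φ · x) v = x (φ⁻¹ v)`. -/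
def relabel {d : ℕ} (φ : regularTree d ≃g regularTree d) (x : TreeLabelling d) :
    TreeLabelling d :=
  fun v => x (φ.symm v)

/-- A factor on `𝕋_d`: a measurable `{0, 1}`-valued function of the labelling which is invariant
under all root-preserving automorphisms. -/
structure IsFactor {d : ℕ} (f : TreeLabelling d → Bool) : Prop where
  measurable : Measurable f
  invariant : ∀ φ : regularTree d ≃g regularTree d, φ (treeRoot d) = treeRoot d →
    ∀ x, f (relabel φ x) = f x

/-- The set-valued process `I` generated by `f`: the vertex `v` belongs to `I` if
`f (φ · X) = 1`, where `φ` is an automorphism that maps `v` to the root.  Such a `φ` exists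
(`exists_iso_root`), and its choice does not matter if `f` is a factor
(`mem_factorProcess_iff`). -/
def factorProcess {d : ℕ} (f : TreeLabelling d → Bool) (x : TreeLabelling d) :
    Set (TreeVertex d) :=
  {v | ∃ φ : regularTree d ≃g regularTree d, φ v = treeRoot d ∧ f (relabel φ x) = true}

theorem mem_factorProcess_iff {d : ℕ} {f : TreeLabelling d → Bool} (hf : IsFactor f)
    (x : TreeLabelling d) {v : TreeVertex d} (φ : regularTree d ≃g regularTree d)
    (hφ : φ v = treeRoot d) : v ∈ factorProcess f x ↔ f (relabel φ x) = true := by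
  constructor
  · rintro ⟨ψ, hψ, h⟩
    have hr : φ (ψ.symm (treeRoot d)) = treeRoot d := by
      rw [← hψ, RelIso.symm_apply_apply, hφ, hψ]
    have h1 := hf.invariant (ψ.symm.trans φ) hr (relabel ψ x)
    rw [← h, ← h1]
    congr 1
    funext w
    simp [relabel]
  · exact fun h => ⟨φ, hφ, h⟩

/-- Multiplication by the letter `i` at the far end of a word. -/
def endMul {d : ℕ} (i : Fin d) : List (Fin d) → List (Fin d)
  | [] => [i]
  | [a] => if a = i then [] else [a, i]
  | a :: b :: l => a :: endMul i (b :: l)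

theorem endMul_concat {d : ℕ} (i : Fin d) (l : List (Fin d)) : endMul i (l ++ [i]) = l := by
  induction l with
  | nil => simp [endMul]
  | cons a l ih => cases l with
    | nil => simp [endMul]
    | cons b l => simpa [endMul] using ih

theorem endMul_isChain {d : ℕ} (i : Fin d) (l : List (Fin d)) (h : l.IsChain (· ≠ ·)) :
    (endMul i l).IsChain (· ≠ ·) := by
  induction l with
  | nil => simp [endMul]
  | cons a l ih => cases l with
    | nil => by_cases hai : a = i <;> simp [endMul, hai]
    | cons b l =>
      rw [List.isChain_cons_cons] at h
      have ih' := ih h.2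
      cases l with
      | nil => by_cases hbi : b = i <;> simp_all [endMul]
      | cons c l => simp_all [endMul]

theorem endMul_endMul {d : ℕ} (i : Fin d) (l : List (Fin d)) (h : l.IsChain (· ≠ ·)) :
    endMul i (endMul i l) = l := by
  induction l with
  | nil => simp [endMul]
  | cons a l ih => cases l with
    | nil => by_cases hai : a = i <;> simp [endMul, hai]
    | cons b l =>
      rw [List.isChain_cons_cons] at h
      have ih' := ih h.2
      cases l with
      | nil => by_cases hbi : b = i <;> simp_all [endMul]
      | cons c l => cases l <;> simp_all [endMul]

theorem endMul_adj {d : ℕ} (i : Fin d) (u v : List (Fin d)) (h : ∃ a, v = a :: u) :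
    (∃ a, endMul i v = a :: endMul i u) ∨ (∃ a, endMul i u = a :: endMul i v) := by
  obtain ⟨a, rfl⟩ := h
  cases u with
  | nil => by_cases hai : a = i <;> simp [endMul, hai]
  | cons b l => exact Or.inl ⟨a, rfl⟩

/-- The automorphism of `𝕋_d` given by `endMul i`. -/
def endMulIso {d : ℕ} (i : Fin d) : regularTree d ≃g regularTree d where
  toFun w := ⟨endMul i w.1, endMul_isChain i w.1 w.2⟩
  invFun w := ⟨endMul i w.1, endMul_isChain i w.1 w.2⟩
  left_inv w := Subtype.ext (endMul_endMul i w.1 w.2)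
  right_inv w := Subtype.ext (endMul_endMul i w.1 w.2)
  map_rel_iff' := by
    have key : ∀ u v : List (Fin d), ((∃ a, v = a :: u) ∨ (∃ a, u = a :: v)) →
        (∃ a, endMul i v = a :: endMul i u) ∨ (∃ a, endMul i u = a :: endMul i v) := by
      rintro u v (h | h)
      · exact endMul_adj i u v h
      · exact (endMul_adj i v u h).symm
    intro u v
    refine ⟨fun h => ?_, fun h => key u.1 v.1 h⟩
    have := key _ _ h
    simp only [Equiv.coe_fn_mk, endMul_endMul i u.1 u.2, endMul_endMul i v.1 v.2] at this
    exact this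

/-- The automorphism group of `𝕋_d` acts transitively on the vertices. -/
theorem exists_iso_root {d : ℕ} (v : TreeVertex d) :
    ∃ φ : regularTree d ≃g regularTree d, φ v = treeRoot d := by
  obtain ⟨l, hl⟩ := v
  induction l using List.reverseRecOn with
  | nil => exact ⟨RelIso.refl _, rfl⟩
  | append_singleton l i ih =>
    have hl' : l.IsChain (· ≠ ·) := (List.isChain_append.1 hl).1
    obtain ⟨φ, hφ⟩ := ih hl'
    refine ⟨(endMulIso i).trans φ, ?_⟩
    rw [← hφ]
    exact congrArg φ (Subtype.ext (endMul_concat i l))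

/-- `f` is a factor whose process is with probability one an independent set of `𝕋_d`. -/
structure IsIndepSetFactor {d : ℕ} (f : TreeLabelling d → Bool) : Prop where
  isFactor : IsFactor f
  indep : ∀ᵐ x ∂(labelMeasure d), (regularTree d).IsIndepSet (factorProcess f x)

/-- The density of the process generated by `f`: the probability that it contains the root. -/
noncomputable def factorDensity {d : ℕ} (f : TreeLabelling d → Bool) : ℝ :=
  (labelMeasure d).real {x | treeRoot d ∈ factorProcess f x}

/-- The supremum of the densities of factor of i.i.d. independent sets in `𝕋_d`. -/
noncomputable def supIndepDensity (d : ℕ) : ℝ :=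
  sSup {ρ | ∃ f : TreeLabelling d → Bool, IsIndepSetFactor f ∧ ρ = factorDensity f}

/-- The number `α_d` with `α_d * (log d / d) = supIndepDensity d` (meaningful for `d ≥ 2`). -/
noncomputable def treeAlpha (d : ℕ) : ℝ := supIndepDensity d / (Real.log d / d)

/-!
*Upper bound.* A factor is approximated by a rule that looks at the labels, quantised to finitely
many values, in a ball about the root. Such a rule can be run at every vertex of a finite
`d`-regular graph of large girth. When the labels are revealed one at a time, a label raises the
mutual information across an edge only if it is within reach of both ends, and in a tree-like
graph the increments over all edges are controlled by the entropy increments at the vertices.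
Hence `d` times the probability that two independent outputs are in conflict is at most twice the
entropy of an output. For a single independent set of density `ρ` this gives
`d ρ ≤ 2 (log (1 / ρ) + O(1))`, a factor of two too large. The factor is gained by applying the
inequality to `m` copies of the set that share the labels whose coin does not ask for resampling,
where `m` is geometric and the bias of the coins is tuned by the intermediate value theorem.

*Lower bound.* The greedy algorithm that scans the vertices in the order of their labels and adds
a vertex unless it has a neighbour that was added before is a limit of factors. In a tree with
`d - 1` children per vertex, the time at which a vertex joins has distribution function `y` with
`y' = (1 - y) ^ (d - 1)`, which is solved explicitly and gives density `(1 + o(1)) log d / d`.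
-/

section ProductWeights

variable {V B Λ Λ' : Type*} [Fintype V] [DecidableEq V] [Fintype B] [DecidableEq B]
  [Fintype Λ] [Fintype Λ']

/-- The law of independent labels with law `w`. A probability law on a finite type is encoded as
an element of `stdSimplex ℝ Λ`, the function of its point masses. -/
noncomputable def piWeight {V Λ : Type*} [Fintype V] (w : Λ → ℝ) (z : V → Λ) : ℝ :=
  ∏ v, w (z v)

/-- The law of a pair of independent variables with laws `w` and `w'`. -/
noncomputable def prodWeight {Λ Λ' : Type*} (w : Λ → ℝ) (w' : Λ' → ℝ) (t : Λ × Λ') : ℝ :=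
  w t.1 * w' t.2

/-- The expectation of `F` under independent labels with law `w`. -/
noncomputable def piExpect (w : Λ → ℝ) (F : (V → Λ) → ℝ) : ℝ :=
  ∑ z, piWeight w z * F z

theorem piWeight_nonneg {V Λ : Type*} [Fintype V] {w : Λ → ℝ} (hw : ∀ t, 0 ≤ w t) (z : V → Λ) :
    0 ≤ piWeight w z :=
  Finset.prod_nonneg fun _ _ => hw _

theorem sum_piWeight {w : Λ → ℝ} (hw : ∑ t, w t = 1) : ∑ z : V → Λ, piWeight w z = 1 := by
  simp only [piWeight, ← Fintype.prod_sum fun (_ : V) t => w t, hw, Finset.prod_const_one]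

theorem piWeight_mem_stdSimplex {w : Λ → ℝ} (hw : w ∈ stdSimplex ℝ Λ) :
    piWeight w ∈ stdSimplex ℝ (V → Λ) :=
  ⟨piWeight_nonneg hw.1, sum_piWeight hw.2⟩

theorem prodWeight_mem_stdSimplex {w : Λ → ℝ} {w' : Λ' → ℝ} (hw : w ∈ stdSimplex ℝ Λ)
    (hw' : w' ∈ stdSimplex ℝ Λ') : prodWeight w w' ∈ stdSimplex ℝ (Λ × Λ') := by
  refine ⟨fun t => mul_nonneg (hw.1 _) (hw'.1 _), ?_⟩
  simp only [prodWeight, Fintype.sum_prod_type, ← Fintype.sum_mul_sum, hw.2, hw'.2, one_mul]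

theorem piExpect_const {w : Λ → ℝ} (hw : ∑ t, w t = 1) (c : ℝ) :
    piExpect (V := V) w (fun _ => c) = c := by
  rw [piExpect, ← Finset.sum_mul, sum_piWeight hw, one_mul]

theorem piExpect_mono {w : Λ → ℝ} (hw : ∀ t, 0 ≤ w t) {F G : (V → Λ) → ℝ}
    (h : ∀ z, F z ≤ G z) : piExpect w F ≤ piExpect w G :=
  Finset.sum_le_sum fun z _ => mul_le_mul_of_nonneg_left (h z) (piWeight_nonneg hw z)

theorem piExpect_nonneg {w : Λ → ℝ} (hw : ∀ t, 0 ≤ w t) {F : (V → Λ) → ℝ}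
    (h : ∀ z, 0 ≤ F z) : 0 ≤ piExpect w F :=
  Finset.sum_nonneg fun z _ => mul_nonneg (piWeight_nonneg hw z) (h z)

theorem piExpect_sub (w : Λ → ℝ) (F G : (V → Λ) → ℝ) :
    piExpect w (fun z => F z - G z) = piExpect w F - piExpect w G := by
  simp only [piExpect, mul_sub, Finset.sum_sub_distrib]

theorem piExpect_sum {ι : Type*} (w : Λ → ℝ) (s : Finset ι) (F : ι → (V → Λ) → ℝ) :
    piExpect w (fun z => ∑ i ∈ s, F i z) = ∑ i ∈ s, piExpect w (F i) := by
  simp only [piExpect, Finset.mul_sum]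
  exact Finset.sum_comm

theorem piExpect_prodWeight (w : Λ → ℝ) (w' : Λ' → ℝ) (G : (V → Λ) → (V → Λ') → ℝ) :
    piExpect (prodWeight w w') (fun z => G (fun v => (z v).1) (fun v => (z v).2)) =
      piExpect w fun x => piExpect w' fun y => G x y := by
  simp only [piExpect, Finset.mul_sum]
  rw [← Fintype.sum_prod_type' (f := fun (x : V → Λ) (y : V → Λ') =>
      piWeight w x * (piWeight w' y * G x y)),
    ← Equiv.sum_comp (Equiv.arrowProdEquivProdArrow V (fun _ => Λ) (fun _ => Λ'))]
  refine Finset.sum_congr rfl fun z _ => ?_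
  simp only [piWeight, prodWeight, Finset.prod_mul_distrib, mul_assoc]
  rfl

theorem piExpect_piWeight_prod {ι : Type*} [Fintype ι] [DecidableEq ι] (w : Λ → ℝ)
    (H : ι → (V → Λ) → ℝ) :
    piExpect (piWeight w) (fun y : V → ι → Λ => ∏ i, H i (fun v => y v i)) =
      ∏ i, piExpect w (H i) := by
  simp only [piExpect]
  rw [Fintype.prod_sum, ← Equiv.sum_comp (Equiv.piComm fun (_ : V) (_ : ι) => Λ)]
  refine Finset.sum_congr rfl fun y _ => ?_
  simp only [piWeight, Finset.prod_mul_distrib]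
  rw [Finset.prod_comm]
  rfl

theorem piExpect_single [DecidableEq Λ] (t₀ : Λ) (G : (V → Λ) → ℝ) :
    piExpect (Pi.single t₀ 1) G = G fun _ => t₀ := by
  rw [piExpect, Finset.sum_eq_single fun _ => t₀]
  · simp [piWeight]
  · intro z _ hz
    obtain ⟨v, hv⟩ := Function.ne_iff.1 hz
    rw [piWeight, Finset.prod_eq_zero (Finset.mem_univ v) (Pi.single_eq_of_ne hv 1), zero_mul]
  · simp

/-- Change of variables for a map `g` that sends the law `w` of the labels to the law `w'`. -/
theorem piExpect_comp_eq_of_fiberwise {w : Λ → ℝ} {w' : Λ' → ℝ} {g : (V → Λ) → B → Λ'}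
    [DecidableEq (B → Λ')]
    (hg : ∀ y, ∑ z with g z = y, piWeight w z = piWeight w' y) (Φ : (B → Λ') → ℝ) :
    piExpect w (fun z => Φ (g z)) = piExpect w' Φ := by
  simp only [piExpect, ← hg]
  rw [← Finset.sum_fiberwise (s := Finset.univ) (g := g)]
  refine Finset.sum_congr rfl fun y _ => ?_
  rw [Finset.sum_mul]
  exact Finset.sum_congr rfl fun z hz => by rw [(Finset.mem_filter.1 hz).2]

theorem piExpect_comp_map [DecidableEq Λ'] (w : Λ → ℝ) (κ : Λ → Λ') (Φ : (V → Λ') → ℝ) :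
    piExpect w (fun z => Φ (κ ∘ z)) = piExpect (fun t' => ∑ t with κ t = t', w t) Φ := by
  refine piExpect_comp_eq_of_fiberwise (g := fun z => κ ∘ z) (fun y => ?_) Φ
  simp only [piWeight]
  rw [Finset.prod_univ_sum]
  refine Finset.sum_congr ?_ fun _ _ => rfl
  ext z
  simp [Fintype.mem_piFinset, funext_iff]

theorem piExpect_comp_injective {w : Λ → ℝ} (hw : ∑ t, w t = 1) {ι : B → V}
    (hι : Function.Injective ι) (Φ : (B → Λ) → ℝ) :
    piExpect w (fun z : V → Λ => Φ (z ∘ ι)) = piExpect w Φ := by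
  classical
  refine piExpect_comp_eq_of_fiberwise (g := fun z : V → Λ => z ∘ ι) (fun y => ?_) Φ
  let allowed (v : V) : Finset Λ := {t | ∀ b, ι b = v → t = y b}
  have fiber_eq : ({z | z ∘ ι = y} : Finset (V → Λ)) = Fintype.piFinset allowed := by
    ext z
    simp only [Finset.mem_filter_univ, funext_iff, Function.comp_apply, Fintype.mem_piFinset,
      allowed]
    exact ⟨fun h v b hb => hb ▸ h b, fun h b => h _ b rfl⟩
  have sum_range (b : B) : ∑ t ∈ allowed (ι b), w t = w (y b) := by
    have : allowed (ι b) = {y b} := by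
      ext t
      simp [allowed, hι.eq_iff]
    rw [this, Finset.sum_singleton]
  have sum_off_range (v : V) (hv : v ∉ Set.range ι) : ∑ t ∈ allowed v, w t = 1 := by
    have : allowed v = Finset.univ :=
      Finset.filter_true_of_mem fun t _ b hb => absurd ⟨b, hb⟩ hv
    rw [this, hw]
  simp only [piWeight]
  rw [fiber_eq, ← Finset.prod_univ_sum]
  exact (Fintype.prod_of_injective ι hι _ _ sum_off_range fun b => (sum_range b).symm).symm

/-- Resampling the labels in `S` maps the pair formed by the labelling and its fresh copy to a pair
with the same law, since exchanging the two labels at each vertex of `S` is an involution. -/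
theorem piExpect_piExpect_piecewise {w : Λ → ℝ} (hw : ∑ t, w t = 1) (S : Finset V)
    (F : (V → Λ) → ℝ) :
    piExpect w (fun z => piExpect w fun z' => F (S.piecewise z' z)) = piExpect w F := by
  let swap (p : (V → Λ) × (V → Λ)) : (V → Λ) × (V → Λ) :=
    (S.piecewise p.2 p.1, S.piecewise p.1 p.2)
  have swap_involutive : Function.Involutive swap := by
    rintro ⟨z, z'⟩
    ext v <;> by_cases hv : v ∈ S <;> simp [swap, hv]
  have weight_swap (p : (V → Λ) × (V → Λ)) :
      piWeight w (swap p).1 * piWeight w (swap p).2 = piWeight w p.1 * piWeight w p.2 := by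
    simp only [piWeight, ← Finset.prod_mul_distrib]
    refine Finset.prod_congr rfl fun v _ => ?_
    by_cases hv : v ∈ S <;> simp [swap, hv, mul_comm]
  calc piExpect w (fun z => piExpect w fun z' => F (S.piecewise z' z))
      = ∑ p : (V → Λ) × (V → Λ), piWeight w p.1 * piWeight w p.2 * F (swap p).1 := by
        simp only [piExpect, Fintype.sum_prod_type, Finset.mul_sum, mul_assoc, swap]
    _ = ∑ p : (V → Λ) × (V → Λ), piWeight w p.1 * piWeight w p.2 * F p.1 := by
        rw [← Equiv.sum_comp swap_involutive.toPerm fun p => _ * _ * F p.1]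
        refine Finset.sum_congr rfl fun p _ => ?_
        rw [Function.Involutive.coe_toPerm, weight_swap]
    _ = piExpect w fun z => piExpect w fun _ => F z := by
        simp only [piExpect, Fintype.sum_prod_type, Finset.mul_sum, mul_assoc]
        rfl
    _ = piExpect w F := by simp only [piExpect_const hw]

end ProductWeights

section Entropy

open Real (log negMulLog)

theorem negMulLog_add_mul_log_le {x y : ℝ} (hx : 0 ≤ x) (hy : 0 ≤ y) (hxy : y = 0 → x = 0) :
    negMulLog x + x * log y ≤ y - x := by
  rcases hx.eq_or_lt with rfl | hx
  · simpa using hy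
  have hy : 0 < y := hy.lt_of_ne fun h => hx.ne' (hxy h.symm)
  calc negMulLog x + x * log y = x * log (y / x) := by
        rw [Real.log_div hy.ne' hx.ne', negMulLog]; ring
    _ ≤ x * (y / x - 1) :=
        mul_le_mul_of_nonneg_left (Real.log_le_sub_one_of_pos (div_pos hy hx)) hx.le
    _ = y - x := by field_simp

/-- The log-sum inequality: the relative entropy is jointly convex. -/
theorem sum_mul_negMulLog_add_mul_log_le {ι : Type*} (s : Finset ι) {u p q : ι → ℝ}
    (hu : ∀ i, 0 ≤ u i) (hp : ∀ i, 0 ≤ p i) (hq : ∀ i, 0 ≤ q i) (hpq : ∀ i, q i = 0 → p i = 0) :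
    ∑ i ∈ s, u i * (negMulLog (p i) + p i * log (q i)) ≤
      negMulLog (∑ i ∈ s, u i * p i) + (∑ i ∈ s, u i * p i) * log (∑ i ∈ s, u i * q i) := by
  set P := ∑ i ∈ s, u i * p i with hP
  set Q := ∑ i ∈ s, u i * q i with hQ
  have term_nonneg (i : ι) : 0 ≤ u i * p i := mul_nonneg (hu i) (hp i)
  have hP_nonneg : 0 ≤ P := Finset.sum_nonneg fun i _ => term_nonneg i
  rcases hP_nonneg.eq_or_lt with hP0 | hP0
  · refine (Finset.sum_nonpos fun i hi => ?_).trans_eq (by simp [← hP0])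
    have := (Finset.sum_eq_zero_iff_of_nonneg fun i _ => term_nonneg i).1 hP0.symm i hi
    rcases mul_eq_zero.1 this with h | h <;> simp [h]
  have hQ0 : 0 < Q := by
    refine (Finset.sum_nonneg fun i _ => mul_nonneg (hu i) (hq i)).lt_of_ne fun h => hP0.ne' ?_
    refine Finset.sum_eq_zero fun i hi => ?_
    have := (Finset.sum_eq_zero_iff_of_nonneg fun i _ => mul_nonneg (hu i) (hq i)).1 h.symm i hi
    rcases mul_eq_zero.1 this with h | h
    · simp [h]
    · simp [hpq i h]
  have tangent (i : ι) :
      negMulLog (p i) + p i * log (q i) ≤ (P / Q * q i - p i) - p i * log (P / Q) := by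
    have := negMulLog_add_mul_log_le (hp i) (mul_nonneg (div_pos hP0 hQ0).le (hq i))
      (by simpa [hP0.ne', hQ0.ne'] using hpq i)
    by_cases h : q i = 0
    · simp [h, hpq i h]
    · rw [Real.log_mul (div_pos hP0 hQ0).ne' h] at this
      linarith
  calc ∑ i ∈ s, u i * (negMulLog (p i) + p i * log (q i))
      ≤ ∑ i ∈ s, u i * ((P / Q * q i - p i) - p i * log (P / Q)) :=
        Finset.sum_le_sum fun i _ => mul_le_mul_of_nonneg_left (tangent i) (hu i)
    _ = (P / Q * Q - P) - P * log (P / Q) := by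
        rw [hP, hQ, Finset.mul_sum, Finset.sum_mul, ← Finset.sum_sub_distrib,
          ← Finset.sum_sub_distrib]
        exact Finset.sum_congr rfl fun i _ => by ring
    _ = negMulLog P + P * log Q := by
        rw [div_mul_cancel₀ _ hQ0.ne', Real.log_div hP0.ne' hQ0.ne', negMulLog]
        ring

variable {A A' : Type*} [Fintype A] [Fintype A'] [DecidableEq A']

/-- The Shannon entropy, in nats, of a probability law on a finite type. -/
noncomputable def shannonEntropy (p : A → ℝ) : ℝ := ∑ a, negMulLog (p a)

theorem shannonEntropy_sub_map (p : A → ℝ) (κ : A → A') (q : A' → ℝ)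
    (hq : ∀ b, q b = ∑ a with κ a = b, p a) :
    shannonEntropy p - shannonEntropy q = ∑ a, (negMulLog (p a) + p a * log (q (κ a))) := by
  have entropy_map : shannonEntropy q = -∑ a, p a * log (q (κ a)) := by
    rw [shannonEntropy, ← Finset.sum_fiberwise (s := Finset.univ) (g := κ),
      ← Finset.sum_neg_distrib]
    refine Finset.sum_congr rfl fun b _ => ?_
    rw [negMulLog, neg_mul, neg_inj]
    conv_lhs => rw [hq b, Finset.sum_mul, ← hq b]
    exact Finset.sum_congr rfl fun a ha => by rw [(Finset.mem_filter.1 ha).2]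
  rw [entropy_map, Finset.sum_add_distrib, shannonEntropy, sub_neg_eq_add]

variable [DecidableEq A]

/-- The probability that independent variables with laws `p` and `q` are related by `K`. -/
noncomputable def conflictProb (K : A → A' → Prop) [∀ a b, Decidable (K a b)] (p : A → ℝ)
    (q : A' → ℝ) : ℝ :=
  ∑ a, ∑ b, if K a b then p a * q b else 0

/-- If a coupling `r` of `p` and `q` avoids the relation `K`, its mutual information is at least
the probability of `K` under the product coupling. -/
theorem conflictProb_le_of_coupling {K : A → A' → Prop} [∀ a b, Decidable (K a b)] {p : A → ℝ}
    {q : A' → ℝ} {r : A × A' → ℝ} (hp : p ∈ stdSimplex ℝ A) (hq : q ∈ stdSimplex ℝ A')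
    (hr : r ∈ stdSimplex ℝ (A × A')) (hfst : ∀ a, p a = ∑ x with Prod.fst x = a, r x)
    (hsnd : ∀ b, q b = ∑ x with Prod.snd x = b, r x) (hK : ∀ x, K x.1 x.2 → r x = 0) :
    conflictProb K p q ≤ shannonEntropy p + shannonEntropy q - shannonEntropy r := by
  have le_fst (x : A × A') : r x ≤ p x.1 := by
    rw [hfst]
    exact Finset.single_le_sum (f := r) (fun y _ => hr.1 y) (by simp)
  have le_snd (x : A × A') : r x ≤ q x.2 := by
    rw [hsnd]
    exact Finset.single_le_sum (f := r) (fun y _ => hr.1 y) (by simp)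
  have tangent (x : A × A') :
      (negMulLog (r x) + r x * log (p x.1)) + (negMulLog (r x) + r x * log (q x.2)) -
          negMulLog (r x) ≤
        p x.1 * q x.2 - r x - if K x.1 x.2 then p x.1 * q x.2 else 0 := by
    rcases (hr.1 x).eq_or_lt with h | h
    · split_ifs <;> simp [← h, mul_nonneg (hp.1 x.1) (hq.1 x.2)]
    have hpx : 0 < p x.1 := h.trans_le (le_fst x)
    have hqx : 0 < q x.2 := h.trans_le (le_snd x)
    have := negMulLog_add_mul_log_le h.le (mul_pos hpx hqx).le
      fun h0 => absurd h0 (mul_pos hpx hqx).ne'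
    rw [Real.log_mul hpx.ne' hqx.ne'] at this
    rw [if_neg fun hKx => h.ne' (hK x hKx)]
    linarith
  have summed := Finset.sum_le_sum fun x (_ : x ∈ Finset.univ) => tangent x
  have sum_mul : ∑ x : A × A', p x.1 * q x.2 = 1 := by
    rw [Fintype.sum_prod_type, ← Fintype.sum_mul_sum, hp.2, hq.2, one_mul]
  have conflict_eq : conflictProb K p q = ∑ x : A × A', if K x.1 x.2 then p x.1 * q x.2 else 0 := by
    rw [conflictProb, Fintype.sum_prod_type]
  simp only [Finset.sum_sub_distrib, Finset.sum_add_distrib (f := fun _ => _ + _), sum_mul, hr.2,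
    ← conflict_eq, ← shannonEntropy_sub_map r _ _ hfst, ← shannonEntropy_sub_map r _ _ hsnd]
    at summed
  change _ - shannonEntropy r ≤ _ at summed
  linarith

end Entropy

section ConditionalEntropy

open Real (negMulLog log)

variable {V Λ A A' : Type*} [Fintype V] [DecidableEq V] [Fintype Λ] [DecidableEq A] [DecidableEq A']
  {w : Λ → ℝ} {S T : Finset V}

/-- The law of the random variable `Y` of independent labels with law `w`. -/
noncomputable def law (w : Λ → ℝ) (Y : (V → Λ) → A) (a : A) : ℝ :=
  piExpect w fun z => if Y z = a then 1 else 0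

theorem law_nonneg (hw : ∀ t, 0 ≤ w t) (Y : (V → Λ) → A) (a : A) : 0 ≤ law w Y a :=
  piExpect_nonneg hw fun z => by positivity

theorem law_comp [Fintype A] (Y : (V → Λ) → A) (κ : A → A') (b : A') :
    law w (κ ∘ Y) b = ∑ a with κ a = b, law w Y a := by
  unfold law
  rw [← piExpect_sum]
  refine congrArg (piExpect w) (funext fun z => ?_)
  simp [Finset.sum_ite_eq, Finset.mem_filter]

theorem law_le_law_comp (hw : ∀ t, 0 ≤ w t) (Y : (V → Λ) → A) (κ : A → A') (a : A) :
    law w Y a ≤ law w (κ ∘ Y) (κ a) :=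
  piExpect_mono hw fun z => by
    by_cases h : Y z = a
    · simp [h]
    · rw [if_neg h]; positivity

theorem law_mem_stdSimplex [Fintype A] (hw : w ∈ stdSimplex ℝ Λ) (Y : (V → Λ) → A) :
    law w Y ∈ stdSimplex ℝ A := by
  refine ⟨law_nonneg hw.1 Y, ?_⟩
  unfold law
  rw [← piExpect_sum]
  simp [piExpect_const hw.2]

/-- The conditional law of `Y` at `z` when the labels outside `S` are known: the labels in the
finite set `S` of forgotten vertices are resampled. -/
noncomputable def condLaw (w : Λ → ℝ) (S : Finset V) (Y : (V → Λ) → A) (z : V → Λ) : A → ℝ :=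
  law w fun z' => Y (S.piecewise z' z)

theorem condLaw_tower (hw : ∑ t, w t = 1) (hST : S ⊆ T) (Y : (V → Λ) → A) (z : V → Λ) (a : A) :
    condLaw w T Y z a = piExpect w fun z' => condLaw w S Y (T.piecewise z' z) a := by
  have nested (z' z'' : V → Λ) :
      S.piecewise z'' (T.piecewise z' z) = T.piecewise (S.piecewise z'' z') z := by
    ext v
    by_cases hS : v ∈ S
    · simp [hS, hST hS]
    · by_cases hT : v ∈ T <;> simp [hT, hS]
  simp only [condLaw, law, nested]
  exact (piExpect_piExpect_piecewise hw S fun y => if Y (T.piecewise y z) = a then 1 else 0).symm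

/-- The conditional entropy of `Y` given the labels outside `S`. -/
noncomputable def condEntropy [Fintype A] (w : Λ → ℝ) (S : Finset V) (Y : (V → Λ) → A) : ℝ :=
  piExpect w fun z => shannonEntropy (condLaw w S Y z)

theorem condEntropy_empty [Fintype A] (hw : ∑ t, w t = 1) (Y : (V → Λ) → A) :
    condEntropy w ∅ Y = 0 := by
  have entropy_zero (z : V → Λ) : shannonEntropy (condLaw w ∅ Y z) = 0 :=
    Finset.sum_eq_zero fun a _ => by
      by_cases h : Y z = a <;> simp [condLaw, law, h, piExpect_const hw]
  simp only [condEntropy, entropy_zero, piExpect_const hw]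

theorem condEntropy_univ [Fintype A] (hw : ∑ t, w t = 1) (Y : (V → Λ) → A) :
    condEntropy w Finset.univ Y = shannonEntropy (law w Y) := by
  simp only [condEntropy, condLaw, Finset.piecewise_univ, piExpect_const hw]

theorem condEntropy_insert_of_dependsOn [Fintype A] {Y : (V → Λ) → A} {h : V}
    (hY : DependsOn Y {h}ᶜ) : condEntropy w (insert h S) Y = condEntropy w S Y := by
  have forget_insert (z z' : V → Λ) : Y ((insert h S).piecewise z' z) = Y (S.piecewise z' z) :=
    hY fun _ hv => by
      simp [Finset.piecewise, Set.mem_compl_singleton_iff.1 hv]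
  simp only [condEntropy, condLaw, forget_insert]

theorem condEntropy_sub_comp_mono [Fintype A] [Fintype A'] (hw : w ∈ stdSimplex ℝ Λ) (hST : S ⊆ T)
    (Y : (V → Λ) → A) (κ : A → A') :
    condEntropy w S Y - condEntropy w S (κ ∘ Y) ≤ condEntropy w T Y - condEntropy w T (κ ∘ Y) := by
  let gap (p : A → ℝ) (q : A' → ℝ) (a : A) : ℝ := negMulLog (p a) + p a * log (q (κ a))
  have condEntropy_sub (R : Finset V) : condEntropy w R Y - condEntropy w R (κ ∘ Y) =
      piExpect w fun z => ∑ a, gap (condLaw w R Y z) (condLaw w R (κ ∘ Y) z) a := by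
    rw [condEntropy, condEntropy, ← piExpect_sub]
    exact congrArg (piExpect w) (funext fun z => shannonEntropy_sub_map _ κ _
      (law_comp (fun z' => Y (R.piecewise z' z)) κ))
  rw [condEntropy_sub, condEntropy_sub, ← piExpect_piExpect_piecewise hw.2 T]
  refine piExpect_mono hw.1 fun z => ?_
  rw [piExpect_sum]
  refine Finset.sum_le_sum fun a _ => ?_
  simp only [gap, condLaw_tower hw.2 hST _ z]
  exact sum_mul_negMulLog_add_mul_log_le Finset.univ (piWeight_nonneg hw.1)
    (fun _ => law_nonneg hw.1 _ _) (fun _ => law_nonneg hw.1 _ _)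
    fun z' h => le_antisymm (h ▸ law_le_law_comp hw.1 _ κ a) (law_nonneg hw.1 _ _)

theorem condEntropy_mono [Fintype A] (hw : w ∈ stdSimplex ℝ Λ) (hST : S ⊆ T) (Y : (V → Λ) → A) :
    condEntropy w S Y ≤ condEntropy w T Y := by
  have const_entropy (R : Finset V) : condEntropy w R ((fun _ => ()) ∘ Y) = 0 := by
    simp [condEntropy, shannonEntropy, condLaw, law, piExpect_const hw.2]
  simpa [const_entropy] using condEntropy_sub_comp_mono hw hST Y fun _ => ()

/-- The conditional mutual information of `Y` and `Y'` given the labels outside `S`. -/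
noncomputable def condMutualInfo [Fintype A] [Fintype A'] (w : Λ → ℝ) (S : Finset V)
    (Y : (V → Λ) → A) (Y' : (V → Λ) → A') : ℝ :=
  condEntropy w S Y + condEntropy w S Y' - condEntropy w S fun z => (Y z, Y' z)

theorem condMutualInfo_sub_le_min [Fintype A] [Fintype A'] (hw : w ∈ stdSimplex ℝ Λ) (hST : S ⊆ T)
    (Y : (V → Λ) → A) (Y' : (V → Λ) → A') :
    condMutualInfo w T Y Y' - condMutualInfo w S Y Y' ≤
      min (condEntropy w T Y - condEntropy w S Y) (condEntropy w T Y' - condEntropy w S Y') := by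
  have given_fst := condEntropy_sub_comp_mono hw hST (fun z => (Y z, Y' z)) Prod.fst
  have given_snd := condEntropy_sub_comp_mono hw hST (fun z => (Y z, Y' z)) Prod.snd
  simp only [Function.comp_def] at given_fst given_snd
  rw [condMutualInfo, condMutualInfo, le_min_iff]
  constructor <;> linarith

theorem condMutualInfo_empty [Fintype A] [Fintype A'] (hw : ∑ t, w t = 1) (Y : (V → Λ) → A)
    (Y' : (V → Λ) → A') : condMutualInfo w ∅ Y Y' = 0 := by
  simp [condMutualInfo, condEntropy_empty hw]

theorem conflictProb_le_condMutualInfo_univ [Fintype A] [Fintype A'] (hw : w ∈ stdSimplex ℝ Λ)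
    {K : A → A' → Prop} [∀ a b, Decidable (K a b)] {Y : (V → Λ) → A} {Y' : (V → Λ) → A'}
    (hK : ∀ z, ¬ K (Y z) (Y' z)) :
    conflictProb K (law w Y) (law w Y') ≤ condMutualInfo w Finset.univ Y Y' := by
  rw [condMutualInfo, condEntropy_univ hw.2, condEntropy_univ hw.2, condEntropy_univ hw.2]
  refine conflictProb_le_of_coupling (law_mem_stdSimplex hw Y) (law_mem_stdSimplex hw Y')
    (law_mem_stdSimplex hw _) (law_comp (fun z => (Y z, Y' z)) Prod.fst)
    (law_comp (fun z => (Y z, Y' z)) Prod.snd) fun x hx => ?_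
  have avoid (z : V → Λ) : (Y z, Y' z) ≠ x := by rintro rfl; exact hK z hx
  simp [law, avoid, piExpect_const hw.2]

end ConditionalEntropy

section LocallyTreeGraphs

variable {d : ℕ} {V : Type*}

/-- Left multiplication of a word by a letter in the free product of `d` groups of order two, of
which `𝕋_d` is the Cayley graph. -/
def headMul (j : Fin d) : List (Fin d) → List (Fin d)
  | [] => [j]
  | a :: l => if a = j then l else j :: a :: l

theorem headMul_isChain (j : Fin d) {l : List (Fin d)} (h : l.IsChain (· ≠ ·)) :
    (headMul j l).IsChain (· ≠ ·) := by
  cases l with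
  | nil => simp [headMul]
  | cons a l =>
    by_cases haj : a = j
    · simpa [headMul, haj] using h.tail
    · simp [headMul, haj, List.isChain_cons_cons, h, Ne.symm haj]

theorem headMul_of_isChain_cons {j : Fin d} {l : List (Fin d)}
    (h : (j :: l).IsChain (· ≠ ·)) : headMul j l = j :: l := by
  cases l with
  | nil => rfl
  | cons a l =>
    rw [List.isChain_cons_cons] at h
    simp [headMul, h.1.symm]

theorem headMul_headMul (j : Fin d) {l : List (Fin d)} (h : l.IsChain (· ≠ ·)) :
    headMul j (headMul j l) = l := by
  cases l with
  | nil => simp [headMul]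
  | cons a l =>
    by_cases haj : a = j
    · subst haj
      rw [headMul, if_pos rfl, headMul_of_isChain_cons h]
    · simp [headMul, haj]

/-- The ball of radius `R` about the root of `𝕋_d`. -/
def wordBall (d R : ℕ) : Set (TreeVertex d) := {v | v.1.length ≤ R}

theorem wordBall_finite (d R : ℕ) : (wordBall d R).Finite :=
  Set.Finite.preimage Subtype.val_injective.injOn (List.finite_length_le (Fin d) R)

noncomputable instance (d R : ℕ) : Fintype (wordBall d R) := (wordBall_finite d R).fintype

theorem wordBall_mono {R N : ℕ} (h : R ≤ N) : wordBall d R ⊆ wordBall d N :=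
  fun _ hv => le_trans hv h

/-- The end of the walk from `g` along the word `v`, read from right to left, in the graph on `V`
whose edges labelled by the letter `j` join `g` to `s j g`. -/
def walkEnd (s : Fin d → V → V) (v : TreeVertex d) (g : V) : V := v.1.foldr s g

theorem walkEnd_endMulIso {s : Fin d → V → V} (hs : ∀ j, Function.Involutive (s j)) (j : Fin d)
    (v : TreeVertex d) (g : V) : walkEnd s (endMulIso j v) g = walkEnd s v (s j g) := by
  have foldr_endMul (l : List (Fin d)) : (endMul j l).foldr s g = l.foldr s (s j g) := by
    induction l with
    | nil => rfl
    | cons a l ih =>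
      cases l with
      | nil => by_cases h : a = j <;> simp [endMul, h, hs j g]
      | cons b l => rw [endMul, List.foldr_cons, ih]; rfl
  exact foldr_endMul v.1

/-- The vertices at the end of the walks from `g` along a word of length at most `R`. -/
def walkBall (s : Fin d → V → V) (R : ℕ) (g : V) : Set V := (walkEnd s · g) '' wordBall d R

/-- Every ball of radius `N` in the graph described by `s` is isomorphic to a ball of `𝕋_d`. -/
def LocallyTree (s : Fin d → V → V) (N : ℕ) : Prop :=
  ∀ g, Set.InjOn (walkEnd s · g) (wordBall d N)

theorem LocallyTree.mono {s : Fin d → V → V} {R N : ℕ} (hs : LocallyTree s N) (h : R ≤ N) :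
    LocallyTree s R :=
  fun g => (hs g).mono (wordBall_mono h)

/-- Left multiplication by `j` on the ball of radius `N`, where the words that would leave the
ball are left in place. -/
def ballHeadMul {N : ℕ} (j : Fin d) (v : wordBall d N) : wordBall d N :=
  if h : (headMul j v.1.1).length ≤ N then ⟨⟨headMul j v.1.1, headMul_isChain j v.1.2⟩, h⟩ else v

theorem ballHeadMul_involutive {N : ℕ} (j : Fin d) :
    Function.Involutive (ballHeadMul (N := N) j) := by
  intro v
  by_cases h : (headMul j v.1.1).length ≤ N
  · have hv : v.1.1.length ≤ N := v.2
    simp only [ballHeadMul, h, hv, dif_pos, headMul_headMul j v.1.2]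
  · simp only [ballHeadMul, h, dif_neg, not_false_eq_true]

/-- The permutations of a ball of `𝕋_d` generated by the truncated left multiplications have a
Cayley graph of large girth: a reduced word moves the root of the ball to itself. -/
theorem exists_locallyTree (d N : ℕ) : ∃ (V : Type) (_ : Fintype V) (_ : Nonempty V)
    (s : Fin d → V → V), (∀ j, Function.Involutive (s j)) ∧ LocallyTree s N := by
  classical
  let s (j : Fin d) (g : Equiv.Perm (wordBall d N)) : Equiv.Perm (wordBall d N) :=
    (ballHeadMul_involutive j).toPerm * g
  let root : wordBall d N := ⟨treeRoot d, Nat.zero_le N⟩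
  have walk_root (g : Equiv.Perm (wordBall d N)) (l : List (Fin d)) (hl : l.IsChain (· ≠ ·))
      (hlN : l.length ≤ N) : (l.foldr s g (g⁻¹ root)).1.1 = l := by
    induction l with
    | nil => simp [root, treeRoot]
    | cons j l ih =>
      have ih := ih hl.tail (Nat.le_of_succ_le hlN)
      have step : headMul j (l.foldr s g (g⁻¹ root)).1.1 = j :: l := by
        rw [ih, headMul_of_isChain_cons hl]
      change (ballHeadMul j (l.foldr s g (g⁻¹ root))).1.1 = j :: l
      simp only [ballHeadMul, step, hlN, dif_pos]
  refine ⟨Equiv.Perm (wordBall d N), inferInstance, ⟨1⟩, s, fun j g => ?_,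
    fun g v hv v' hv' h => Subtype.ext ?_⟩
  · ext1 x
    exact ballHeadMul_involutive j (g x)
  · rw [← walk_root g v.1 v.2 hv, ← walk_root g v'.1 v'.2 hv']
    exact congrArg (fun g' : Equiv.Perm (wordBall d N) => (g' (g⁻¹ root)).1.1) h

theorem length_endMul_le (j : Fin d) (l : List (Fin d)) : (endMul j l).length ≤ l.length + 1 := by
  induction l with
  | nil => simp [endMul]
  | cons a l ih =>
    cases l with
    | nil => by_cases h : a = j <;> simp [endMul, h]
    | cons b l => simpa [endMul] using ih

theorem getLast?_endMul_or (j : Fin d) (l : List (Fin d)) :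
    l.getLast? = some j ∨ (endMul j l).getLast? = some j := by
  induction l with
  | nil => simp [endMul]
  | cons a l ih =>
    cases l with
    | nil => by_cases h : a = j <;> simp [endMul, h]
    | cons b l =>
      rw [endMul, List.getLast?_cons_cons]
      refine ih.imp_right fun h => ?_
      rw [List.getLast?_cons, h, Option.getD_some]

/-- Some walk of length at most `R` from `g` to `h` begins with the edge labelled `j`. -/
def ReachedVia (s : Fin d → V → V) (R : ℕ) (g h : V) (j : Fin d) : Prop :=
  ∃ v ∈ wordBall d R, v.1.getLast? = some j ∧ walkEnd s v g = h

theorem ReachedVia.unique {s : Fin d → V → V} {R : ℕ} (hN : LocallyTree s R) {g h : V}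
    {j j' : Fin d} (hj : ReachedVia s R g h j) (hj' : ReachedVia s R g h j') : j = j' := by
  obtain ⟨v, hv, hlast, hend⟩ := hj
  obtain ⟨v', hv', hlast', hend'⟩ := hj'
  obtain rfl := hN g hv hv' (hend.trans hend'.symm)
  exact Option.some.inj (hlast.symm.trans hlast')

theorem reachedVia_or {s : Fin d → V → V} (hs : ∀ j, Function.Involutive (s j)) {R : ℕ}
    (hN : LocallyTree s (R + 1)) {g h : V} (j : Fin d) (hg : h ∈ walkBall s R g)
    (hg' : h ∈ walkBall s R (s j g)) : ReachedVia s R g h j ∨ ReachedVia s R (s j g) h j := by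
  obtain ⟨v, hv, hend⟩ := hg
  obtain ⟨v', hv', hend'⟩ := hg'
  obtain rfl : v = endMulIso j v' := by
    refine hN g (wordBall_mono R.le_succ hv)
      ((length_endMul_le j v'.1).trans (Nat.succ_le_succ hv')) ?_
    exact (hend.trans hend'.symm).trans (walkEnd_endMulIso hs j v' g).symm
  rcases getLast?_endMul_or j v'.1 with hlast | hlast
  · exact .inr ⟨v', hv', hlast, hend'⟩
  · exact .inl ⟨_, hv, hlast, hend⟩

/-- Every edge `{g, s j g}` whose ends are both within distance `R` of `h` is the first edge of the
geodesic to `h` from one of its ends, and each vertex has at most one such edge. -/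
theorem sum_min_edge_le [Fintype V] {s : Fin d → V → V} (hs : ∀ j, Function.Involutive (s j))
    {R : ℕ} (hN : LocallyTree s (R + 1)) {h : V} {a : V → ℝ} (ha : ∀ g, 0 ≤ a g)
    (hsupp : ∀ g, h ∉ walkBall s R g → a g = 0) :
    ∑ g, ∑ j, min (a g) (a (s j g)) ≤ 2 * ∑ g, a g := by
  classical
  let charge (g : V) (j : Fin d) : ℝ := if ReachedVia s R g h j then a g else 0
  have charge_nonneg (g : V) (j : Fin d) : 0 ≤ charge g j := by
    simp only [charge]; split_ifs <;> simp [ha g]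
  have min_le (g : V) (j : Fin d) : min (a g) (a (s j g)) ≤ charge g j + charge (s j g) j := by
    by_cases hg : h ∈ walkBall s R g
    · by_cases hg' : h ∈ walkBall s R (s j g)
      · rcases reachedVia_or hs hN j hg hg' with hr | hr
        · calc min (a g) (a (s j g)) ≤ charge g j := by simp [charge, hr]
            _ ≤ _ := le_add_of_nonneg_right (charge_nonneg _ _)
        · calc min (a g) (a (s j g)) ≤ charge (s j g) j := by simp [charge, hr]
            _ ≤ _ := le_add_of_nonneg_left (charge_nonneg _ _)
      · exact (min_le_right _ _).trans (by
          rw [hsupp _ hg']; exact add_nonneg (charge_nonneg _ _) (charge_nonneg _ _))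
    · exact (min_le_left _ _).trans (by
        rw [hsupp _ hg]; exact add_nonneg (charge_nonneg _ _) (charge_nonneg _ _))
  have sum_charge_le (g : V) : ∑ j, charge g j ≤ a g := by
    have card_le : ({j | ReachedVia s R g h j} : Finset (Fin d)).card ≤ 1 :=
      Finset.card_le_one.2 fun i hi j hj => ReachedVia.unique (hN.mono R.le_succ)
        (Finset.mem_filter.1 hi).2 (Finset.mem_filter.1 hj).2
    calc ∑ j, charge g j = ({j | ReachedVia s R g h j} : Finset (Fin d)).card * a g := by
          simp [charge, ← Finset.sum_filter]
      _ ≤ a g := mul_le_of_le_one_left (ha g) (by exact_mod_cast card_le)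
  have sum_charge_comp : ∑ g, ∑ j, charge (s j g) j = ∑ g, ∑ j, charge g j := by
    rw [Finset.sum_comm, Finset.sum_comm (γ := V)]
    exact Finset.sum_congr rfl fun j _ => Equiv.sum_comp (hs j).toPerm (charge · j)
  calc ∑ g, ∑ j, min (a g) (a (s j g))
      ≤ ∑ g, ∑ j, (charge g j + charge (s j g) j) :=
        Finset.sum_le_sum fun g _ => Finset.sum_le_sum fun j _ => min_le g j
    _ = 2 * ∑ g, ∑ j, charge g j := by
        simp only [Finset.sum_add_distrib, sum_charge_comp, two_mul]
    _ ≤ 2 * ∑ g, a g := by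
        gcongr with g
        exact sum_charge_le g

end LocallyTreeGraphs

section LocalRulesOnGraphs

variable {d R : ℕ} {V Λ A : Type*} {w : Λ → ℝ} {s : Fin d → V → V}

/-- The labelling of `𝕋_d` pulled back from `V` along the walks from `g`. -/
def walkLabels (s : Fin d → V → V) (g : V) (z : V → Λ) (v : TreeVertex d) : Λ := z (walkEnd s v g)

/-- The labelling of `𝕋_d` that extends `z` by a default value. -/
noncomputable def extendBall [Inhabited Λ] (z : wordBall d R → Λ) : TreeVertex d → Λ :=
  Function.extend Subtype.val z default

theorem extendBall_restrict_eqOn [Inhabited Λ] (x : TreeVertex d → Λ) :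
    Set.EqOn (extendBall (x ∘ ((↑) : wordBall d R → TreeVertex d))) x (wordBall d R) :=
  fun v hv => Subtype.val_injective.extend_apply _ _ (⟨v, hv⟩ : wordBall d R)

variable [Fintype V] [DecidableEq V] [Fintype Λ] [DecidableEq A]

/-- The law of the value at the root under a rule `Y` that looks at the ball of radius `R`, applied
to independent labels with law `w`. -/
noncomputable def ruleLaw [Inhabited Λ] (w : Λ → ℝ) (R : ℕ) (Y : (TreeVertex d → Λ) → A) : A → ℝ :=
  law w fun z : wordBall d R → Λ => Y (extendBall z)

theorem law_comp_walkLabels [Inhabited Λ] (hw : ∑ t, w t = 1) (hN : LocallyTree s R)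
    {Y : (TreeVertex d → Λ) → A} (hY : DependsOn Y (wordBall d R)) (g : V) :
    law w (fun z => Y (walkLabels s g z)) = ruleLaw w R Y := by
  funext a
  have walk_injective : Function.Injective fun v : wordBall d R => walkEnd s v.1 g :=
    (hN g).injective
  have restrict_ball (z : V → Λ) :
      Y (walkLabels s g z) = Y (extendBall (z ∘ fun v : wordBall d R => walkEnd s v.1 g)) :=
    (hY (extendBall_restrict_eqOn (walkLabels s g z))).symm
  simp only [law, ruleLaw, restrict_ball]
  exact piExpect_comp_injective hw walk_injective
    fun z : wordBall d R → Λ => if Y (extendBall z) = a then (1 : ℝ) else 0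

variable [Fintype A]

/-- The edge-vertex inequality between entropies: each label known at one more vertex raises the
mutual information across an edge by at most the smaller of the entropy gains at its two ends. -/
theorem sum_condMutualInfo_le (hw : w ∈ stdSimplex ℝ Λ) (hs : ∀ j, Function.Involutive (s j))
    (hN : LocallyTree s (R + 1)) (Y : V → (V → Λ) → A)
    (hY : ∀ g, DependsOn (Y g) (walkBall s R g)) (S : Finset V) :
    ∑ g, ∑ j, condMutualInfo w S (Y g) (Y (s j g)) ≤ 2 * ∑ g, condEntropy w S (Y g) := by
  induction S using Finset.induction_on with
  | empty => simp [condMutualInfo_empty hw.2, condEntropy_empty hw.2]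
  | insert h S _ ih =>
    have hS : S ⊆ insert h S := Finset.subset_insert h S
    have gain_le := sum_min_edge_le hs hN (h := h)
      (a := fun g => condEntropy w (insert h S) (Y g) - condEntropy w S (Y g))
      (fun g => sub_nonneg.2 (condEntropy_mono hw hS (Y g)))
      fun g hg => sub_eq_zero.2 (condEntropy_insert_of_dependsOn
        ((hY g).mono fun v hv => by rintro rfl; exact hg hv))
    have info_le : ∑ g, ∑ j, (condMutualInfo w (insert h S) (Y g) (Y (s j g)) -
        condMutualInfo w S (Y g) (Y (s j g))) ≤ _ :=
      (Finset.sum_le_sum fun g _ => Finset.sum_le_sum fun j _ =>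
        condMutualInfo_sub_le_min hw hS (Y g) (Y (s j g))).trans gain_le
    simp only [Finset.sum_sub_distrib] at info_le
    linarith

theorem degree_mul_conflictProb_le [Inhabited Λ] (hw : w ∈ stdSimplex ℝ Λ)
    {Y : (TreeVertex d → Λ) → A} (hY : DependsOn Y (wordBall d R)) {K : A → A → Prop}
    [DecidableRel K] (hK : ∀ x j, ¬ K (Y x) (Y fun v => x (endMulIso j v))) :
    d * conflictProb K (ruleLaw w R Y) (ruleLaw w R Y) ≤ 2 * shannonEntropy (ruleLaw w R Y) := by
  classical
  obtain ⟨V, _, _, s, hs, hN⟩ := exists_locallyTree d (R + 1)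
  let Z (g : V) (z : V → Λ) : A := Y (walkLabels s g z)
  have law_Z (g : V) : law w (Z g) = ruleLaw w R Y :=
    law_comp_walkLabels hw.2 (hN.mono R.le_succ) hY g
  have Z_dependsOn (g : V) : DependsOn (Z g) (walkBall s R g) := fun x y hxy =>
    hY fun v hv => hxy _ ⟨v, hv, rfl⟩
  have Z_edge (g : V) (j : Fin d) (z : V → Λ) : ¬ K (Z g z) (Z (s j g) z) := by
    have := hK (walkLabels s g z) j
    simp only [walkLabels, walkEnd_endMulIso hs] at this
    exact this
  have conflict_le (g : V) (j : Fin d) : conflictProb K (ruleLaw w R Y) (ruleLaw w R Y) ≤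
      condMutualInfo w Finset.univ (Z g) (Z (s j g)) := by
    simpa only [law_Z] using conflictProb_le_condMutualInfo_univ hw (Z_edge g j)
  have total : ∑ _g : V, ∑ _j : Fin d, conflictProb K (ruleLaw w R Y) (ruleLaw w R Y) ≤
      2 * ∑ _g : V, shannonEntropy (ruleLaw w R Y) := by
    simpa only [condEntropy_univ hw.2, law_Z] using
      (Finset.sum_le_sum fun g _ => Finset.sum_le_sum fun j _ => conflict_le g j).trans
        (sum_condMutualInfo_le hw hs hN Z Z_dependsOn Finset.univ)
  simp only [Finset.sum_const, Finset.card_univ, Fintype.card_fin, nsmul_eq_mul] at total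
  have card_pos : (0 : ℝ) < Fintype.card V := by exact_mod_cast Fintype.card_pos
  exact le_of_mul_le_mul_left (by linarith) card_pos

end LocalRulesOnGraphs

section Copies

variable {V Λ A : Type*}

/-- The law of a coin that shows `true` with probability `p`. -/
def coinWeight (p : ℝ) (b : Bool) : ℝ := if b then p else 1 - p

/-- The law of a base label: a label together with a coin that decides whether the label is
resampled. -/
noncomputable def baseWeight (w : Λ → ℝ) (p : ℝ) : Bool × Λ → ℝ := prodWeight (coinWeight p) w

/-- The law of a base label together with `m` fresh labels. -/
noncomputable def copyWeight (w : Λ → ℝ) (p : ℝ) (m : ℕ) : (Bool × Λ) × (Fin m → Λ) → ℝ :=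
  prodWeight (baseWeight w p) (piWeight w)

/-- The base label, or the fresh label `x` if the coin asks for resampling. -/
def mixLabel (t : Bool × Λ) (x : Λ) : Λ := if t.1 then x else t.2

/-- The values of `m` copies of `F` that share the labels which are not resampled. -/
def copies (F : (V → Λ) → A) (m : ℕ) (x : V → (Bool × Λ) × (Fin m → Λ)) (i : Fin m) : A :=
  F fun v => mixLabel (x v).1 ((x v).2 i)

theorem coinWeight_mem_stdSimplex {p : ℝ} (hp : p ∈ Set.Icc 0 1) :
    coinWeight p ∈ stdSimplex ℝ Bool :=
  ⟨fun b => by cases b <;> simp [coinWeight, hp.1, hp.2], by simp [coinWeight]⟩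

theorem baseWeight_mem_stdSimplex [Fintype Λ] {w : Λ → ℝ} (hw : w ∈ stdSimplex ℝ Λ) {p : ℝ}
    (hp : p ∈ Set.Icc 0 1) : baseWeight w p ∈ stdSimplex ℝ (Bool × Λ) :=
  prodWeight_mem_stdSimplex (coinWeight_mem_stdSimplex hp) hw

theorem conflictProb_mixture {ι : Type*} [Fintype ι] [Fintype A] (K : A → A → Prop)
    [DecidableRel K] (W : ι → ℝ) (P : ι → A → ℝ) :
    conflictProb K (fun a => ∑ i, W i * P i a) (fun b => ∑ i, W i * P i b) =
      ∑ i, ∑ j, W i * W j * conflictProb K (P i) (P j) := by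
  have expand (a b : A) : (if K a b then (∑ i, W i * P i a) * ∑ j, W j * P j b else 0) =
      ∑ i, ∑ j, W i * W j * if K a b then P i a * P j b else 0 := by
    split_ifs with h
    · simp only [Fintype.sum_mul_sum, mul_mul_mul_comm]
    · simp
  simp only [conflictProb, expand]
  simp only [Finset.mul_sum]
  calc ∑ a, ∑ b, ∑ i, ∑ j, W i * W j * (if K a b then P i a * P j b else 0)
      = ∑ a, ∑ i, ∑ j, ∑ b, W i * W j * (if K a b then P i a * P j b else 0) :=
        Finset.sum_congr rfl fun a _ => by
          rw [Finset.sum_comm]; exact Finset.sum_congr rfl fun i _ => Finset.sum_comm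
    _ = ∑ i, ∑ j, ∑ a, ∑ b, W i * W j * (if K a b then P i a * P j b else 0) := by
        rw [Finset.sum_comm]; exact Finset.sum_congr rfl fun i _ => Finset.sum_comm

theorem conflictProb_piWeight_coinWeight (m : ℕ) (x y : ℝ) :
    conflictProb (fun σ τ : Fin m → Bool => ∃ i, σ i = true ∧ τ i = true)
      (piWeight (coinWeight x)) (piWeight (coinWeight y)) = 1 - (1 - x * y) ^ m := by
  let compatible (a b : Bool) : ℝ :=
    if a = true ∧ b = true then 0 else coinWeight x a * coinWeight y b
  have indicator (σ τ : Fin m → Bool) :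
      (if ∃ i, σ i = true ∧ τ i = true then
        piWeight (coinWeight x) σ * piWeight (coinWeight y) τ else 0) =
      piWeight (coinWeight x) σ * piWeight (coinWeight y) τ - ∏ i, compatible (σ i) (τ i) := by
    split_ifs with h
    · obtain ⟨i, hi⟩ := h
      have : ∏ i, compatible (σ i) (τ i) = 0 :=
        Finset.prod_eq_zero (Finset.mem_univ i) (if_pos hi)
      rw [this, sub_zero]
    · rw [eq_comm, sub_eq_zero, piWeight, piWeight, ← Finset.prod_mul_distrib]
      exact Finset.prod_congr rfl fun i _ => (if_neg fun hi => h ⟨i, hi⟩).symm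
  have sum_compatible : ∑ σ : Fin m → Bool, ∑ τ : Fin m → Bool, ∏ i, compatible (σ i) (τ i) =
      (1 - x * y) ^ m := by
    have sum_pair : ∑ a, ∑ b, compatible a b = 1 - x * y := by
      simp only [compatible, coinWeight, Fintype.sum_bool, and_self, if_true, Bool.false_eq_true,
        and_false, false_and, if_false]
      ring
    rw [← sum_pair, Fintype.sum_pow]
    exact Finset.sum_congr rfl fun σ _ => (Fintype.prod_sum fun i b => compatible (σ i) b).symm
  have sum_one (z : ℝ) : ∑ σ : Fin m → Bool, piWeight (coinWeight z) σ = 1 :=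
    sum_piWeight (by simp [coinWeight])
  simp only [conflictProb, indicator, Finset.sum_sub_distrib, sum_compatible,
    ← Fintype.sum_mul_sum, sum_one, one_mul]

/-- A law that is concentrated up to mass `u` on one atom has entropy at most the entropy of
spreading `u` evenly, plus `u`. -/
theorem shannonEntropy_le_of_atom [Fintype A] {p : A → ℝ}
    (hp : p ∈ stdSimplex ℝ A) {a₀ : A} {u : ℝ} (hu : 1 - p a₀ = u) (hu0 : 0 < u) :
    shannonEntropy p ≤ u * (-Real.log u + Real.log (Fintype.card A) + 1) := by
  classical
  have card_pos : (0 : ℝ) < Fintype.card A := by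
    have : Nonempty A := ⟨a₀⟩
    exact_mod_cast Fintype.card_pos
  have sum_erase : ∑ a ∈ Finset.univ.erase a₀, p a = u := by
    rw [← hu, ← hp.2, ← Finset.add_sum_erase _ _ (Finset.mem_univ a₀)]; ring
  have atom_le : Real.negMulLog (p a₀) ≤ u := by
    have := negMulLog_add_mul_log_le (hp.1 a₀) zero_le_one fun h => absurd h one_ne_zero
    rw [Real.log_one] at this
    linarith
  have rest_le : ∑ a ∈ Finset.univ.erase a₀, Real.negMulLog (p a) ≤
      ∑ a ∈ Finset.univ.erase a₀,
        (u / Fintype.card A - p a - p a * Real.log (u / Fintype.card A)) :=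
    Finset.sum_le_sum fun a _ => by
      have := negMulLog_add_mul_log_le (hp.1 a) (div_pos hu0 card_pos).le
        fun h => absurd h (div_pos hu0 card_pos).ne'
      linarith
  have uniform_le : ((Finset.univ.erase a₀).card : ℝ) * (u / Fintype.card A) ≤ u := by
    rw [← mul_div_assoc, div_le_iff₀ card_pos, mul_comm u]
    exact mul_le_mul_of_nonneg_right (Nat.cast_le.2 (Finset.card_le_univ _)) hu0.le
  rw [Finset.sum_sub_distrib, Finset.sum_sub_distrib, ← Finset.sum_mul, sum_erase,
    Finset.sum_const, nsmul_eq_mul, Real.log_div hu0.ne' card_pos.ne'] at rest_le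
  rw [shannonEntropy, ← Finset.add_sum_erase _ _ (Finset.mem_univ a₀)]
  linarith

variable [Fintype V] [DecidableEq V] [Fintype Λ] {w : Λ → ℝ}

theorem law_bool (hw : ∑ t, w t = 1) (F : (V → Λ) → Bool) :
    law w F = coinWeight (law w F true) := by
  funext b
  cases b
  · rw [coinWeight, if_neg Bool.false_ne_true, ← piExpect_const (V := V) hw 1, law, law,
      ← piExpect_sub]
    congr 1
    funext z
    cases F z <;> simp
  · rw [coinWeight, if_pos rfl]

/-- The conditional probability of `F`, given the base labels `ω`, when the labels whose coin
shows `true` are resampled. -/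
noncomputable def condProb (w : Λ → ℝ) (F : (V → Λ) → Bool) (ω : V → Bool × Λ) : ℝ :=
  law w (fun x => F fun v => mixLabel (ω v) (x v)) true

theorem condProb_mem_Icc (hw : w ∈ stdSimplex ℝ Λ) (F : (V → Λ) → Bool) (ω : V → Bool × Λ) :
    condProb w F ω ∈ Set.Icc 0 1 := by
  have := law_mem_stdSimplex hw fun x => F fun v => mixLabel (ω v) (x v)
  exact ⟨this.1 true, (Finset.single_le_sum (fun b _ => this.1 b) (Finset.mem_univ true)).trans_eq
    this.2⟩

theorem piExpect_condProb (hw : ∑ t, w t = 1) (F : (V → Λ) → Bool) (p : ℝ) :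
    piExpect (baseWeight w p) (condProb w F) = law w F true := by
  classical
  have mix_law (t' : Λ) :
      ∑ t : (Bool × Λ) × Λ with mixLabel t.1 t.2 = t', prodWeight (baseWeight w p) w t = w t' := by
    rw [Finset.sum_filter]
    simp only [Fintype.sum_prod_type, Fintype.sum_bool, mixLabel, baseWeight,
      prodWeight, coinWeight, if_true, Bool.false_eq_true, if_false, Finset.sum_ite_eq',
      Finset.mem_univ]
    rw [Finset.sum_comm (γ := Λ)]
    simp only [Finset.sum_ite_eq', Finset.mem_univ, if_true, ← Finset.sum_mul, ← Finset.mul_sum,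
      hw]
    ring
  have merge := piExpect_comp_map (V := V) (prodWeight (baseWeight w p) w)
    (fun t => mixLabel t.1 t.2) fun x => if F x = true then 1 else 0
  simp only [mix_law] at merge
  exact (piExpect_prodWeight (V := V) (baseWeight w p) w
    fun ω x => if F (fun v => mixLabel (ω v) (x v)) = true then 1 else 0).symm.trans merge

theorem piExpect_baseWeight_zero (hw : ∑ t, w t = 1) (F : (V → Λ) → Bool) (φ : ℝ → ℝ) :
    piExpect (baseWeight w 0) (fun ω => φ (condProb w F ω)) =
      piExpect w fun x => φ (if F x = true then 1 else 0) := by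
  have coin_zero : coinWeight 0 = Pi.single false 1 := by
    funext b; cases b <;> simp [coinWeight]
  have split := piExpect_prodWeight (V := V) (coinWeight 0) w
    fun b x => φ (condProb w F fun v => (b v, x v))
  rw [coin_zero, piExpect_single, ← coin_zero] at split
  refine split.trans (congrArg _ (funext fun x => ?_))
  simp only [condProb, law, mixLabel, Bool.false_eq_true, if_false, piExpect_const hw]

theorem piExpect_baseWeight_one (hw : ∑ t, w t = 1) (F : (V → Λ) → Bool) (φ : ℝ → ℝ) :
    piExpect (baseWeight w 1) (fun ω => φ (condProb w F ω)) = φ (law w F true) := by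
  have coin_one : coinWeight 1 = Pi.single true 1 := by
    funext b; cases b <;> simp [coinWeight]
  have split := piExpect_prodWeight (V := V) (coinWeight 1) w
    fun b x => φ (condProb w F fun v => (b v, x v))
  rw [coin_one, piExpect_single, ← coin_one] at split
  refine split.trans ?_
  simp only [condProb, mixLabel, if_true, piExpect_const hw]

theorem continuous_piExpect_baseWeight (w : Λ → ℝ) (G : (V → Bool × Λ) → ℝ) :
    Continuous fun p => piExpect (baseWeight w p) G := by
  have coin_continuous (b : Bool) : Continuous fun p => coinWeight p b := by
    unfold coinWeight; split_ifs <;> fun_prop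
  unfold piExpect piWeight baseWeight prodWeight
  fun_prop

/-- Given the base labels, the copies are independent coins with success probability `condProb`. -/
theorem law_copies (hw : ∑ t, w t = 1) (F : (V → Λ) → Bool) (p : ℝ) (m : ℕ) :
    law (copyWeight w p m) (copies F m) = fun σ =>
      ∑ ω, piWeight (baseWeight w p) ω * piWeight (coinWeight (condProb w F ω)) σ := by
  funext σ
  let agree (ω : V → Bool × Λ) (i : Fin m) (x : V → Λ) : ℝ :=
    if F (fun v => mixLabel (ω v) (x v)) = σ i then 1 else 0
  have split : law (copyWeight w p m) (copies F m) σ = piExpect (baseWeight w p) fun ω =>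
      piExpect (piWeight w) fun y : V → Fin m → Λ => ∏ i, agree ω i fun v => y v i := by
    rw [← piExpect_prodWeight, law, copyWeight]
    congr 1
    funext z
    simp only [agree]
    rw [Finset.prod_ite_zero]
    simp only [funext_iff, copies, Finset.mem_univ, true_imp_iff, Finset.prod_const_one]
  have coin (ω : V → Bool × Λ) (i : Fin m) :
      piExpect w (agree ω i) = coinWeight (condProb w F ω) (σ i) :=
    congrFun (law_bool hw fun x => F fun v => mixLabel (ω v) (x v)) (σ i)
  rw [split]
  simp only [piExpect_piWeight_prod, coin]
  rfl

end Copies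

section Averaging

open Real (log)

/-- The expectation of `1 - (1 - x) ^ m` when `m ≥ 1` is geometric with weights
`δ / (1 + δ) ^ m`. -/
noncomputable def saturate (δ x : ℝ) : ℝ := (1 + δ) * x / (x + δ)

/-- The second moment of the geometric law with weights `δ / (1 + δ) ^ m`. -/
noncomputable def geometricSecondMoment (δ : ℝ) : ℝ := ∑' m : ℕ, δ / (1 + δ) ^ m * (m : ℝ) ^ 2

variable {δ x y : ℝ}

theorem hasSum_saturate (hδ : 0 < δ) (hx : x ∈ Set.Icc (0 : ℝ) 1) :
    HasSum (fun m : ℕ => δ / (1 + δ) ^ m * (1 - (1 - x) ^ m)) (saturate δ x) := by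
  have all : HasSum (fun m : ℕ => (1 / (1 + δ)) ^ m) (1 - 1 / (1 + δ))⁻¹ :=
    hasSum_geometric_of_lt_one (by positivity) (by rw [div_lt_one (by linarith)]; linarith)
  have missed : HasSum (fun m : ℕ => ((1 - x) / (1 + δ)) ^ m) (1 - (1 - x) / (1 + δ))⁻¹ :=
    hasSum_geometric_of_lt_one (div_nonneg (by linarith [hx.2]) (by linarith))
      (by rw [div_lt_one (by linarith)]; linarith [hx.1])
  have term_eq (m : ℕ) : δ / (1 + δ) ^ m * (1 - (1 - x) ^ m) =
      δ * ((1 / (1 + δ)) ^ m - ((1 - x) / (1 + δ)) ^ m) := by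
    simp only [div_pow, one_pow]
    ring
  have value_eq : saturate δ x = δ * ((1 - 1 / (1 + δ))⁻¹ - (1 - (1 - x) / (1 + δ))⁻¹) := by
    have : x + δ ≠ 0 := by linarith [hx.1]
    have all_eq : 1 - 1 / (1 + δ) = δ / (1 + δ) := by field_simp; ring
    have missed_eq : 1 - (1 - x) / (1 + δ) = (x + δ) / (1 + δ) := by field_simp; ring
    rw [saturate, all_eq, missed_eq]
    field_simp
    ring
  simpa only [term_eq, value_eq] using (all.sub missed).mul_left δ

theorem hasSum_geometricSecondMoment (hδ : 0 < δ) :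
    HasSum (fun m : ℕ => δ / (1 + δ) ^ m * (m : ℝ) ^ 2) (geometricSecondMoment δ) := by
  have := summable_pow_mul_geometric_of_norm_lt_one (R := ℝ) 2 (r := 1 / (1 + δ)) (by
    rw [Real.norm_of_nonneg (by positivity), div_lt_one (by linarith)]; linarith)
  refine Summable.hasSum ((this.mul_left δ).congr fun m => ?_)
  rw [one_div_pow]
  ring

theorem geometricSecondMoment_nonneg (hδ : 0 < δ) : 0 ≤ geometricSecondMoment δ :=
  tsum_nonneg fun m => by positivity

/-- A lower bound for the overlap of two sets of copies that becomes bilinear after averaging. -/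
theorem le_saturate_mul (hδ : 0 < δ) (hx : x ∈ Set.Icc (0 : ℝ) 1) (hy : y ∈ Set.Icc (0 : ℝ) 1) :
    (1 + δ) * (x * saturate δ y + saturate δ x * y - x * y) - δ * (saturate δ x * saturate δ y) ≤
      saturate δ (x * y) := by
  obtain ⟨hx0, hx1⟩ := hx
  obtain ⟨hy0, hy1⟩ := hy
  have : 0 < x + δ := by linarith
  have : 0 < y + δ := by linarith
  have : 0 < x * y + δ := by positivity
  have gap : saturate δ (x * y) - ((1 + δ) * (x * saturate δ y + saturate δ x * y - x * y) -
      δ * (saturate δ x * saturate δ y)) =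
      x * y * ((1 + δ) * (x * (1 - x) * (y * (1 - y)))) / ((x + δ) * (y + δ) * (x * y + δ)) := by
    unfold saturate
    field_simp
    ring
  rw [← sub_nonneg, gap]
  have := sub_nonneg.2 hx1
  have := sub_nonneg.2 hy1
  positivity

variable {ι : Type*} [Fintype ι] {W Q : ι → ℝ} {m : ℕ} {D ρ : ℝ}

/-- The probability that one of `m` coins succeeds, for coins that are independent with success
probability `Q i` given an index `i` of law `W`. -/
noncomputable def hitProb (W Q : ι → ℝ) (m : ℕ) : ℝ := ∑ i, W i * (1 - (1 - Q i) ^ m)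

/-- The probability that two independent sequences of `m` coins as in `hitProb` succeed at a common
place. -/
noncomputable def meetProb (W Q : ι → ℝ) (m : ℕ) : ℝ :=
  ∑ i, ∑ j, W i * W j * (1 - (1 - Q i * Q j) ^ m)

theorem le_hitProb (hW : ∀ i, 0 ≤ W i) (hQ : ∀ i, Q i ∈ Set.Icc 0 1) (hm : m ≠ 0) :
    ∑ i, W i * Q i ≤ hitProb W Q m :=
  Finset.sum_le_sum fun i _ => mul_le_mul_of_nonneg_left
    (by linarith [pow_le_of_le_one (sub_nonneg.2 (hQ i).2) (sub_le_self 1 (hQ i).1) hm]) (hW i)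

theorem hitProb_le (hW : ∀ i, 0 ≤ W i) (hQ : ∀ i, Q i ∈ Set.Icc 0 1) :
    hitProb W Q m ≤ m * ∑ i, W i * Q i := by
  rw [Finset.mul_sum]
  refine Finset.sum_le_sum fun i _ => ?_
  rw [mul_left_comm]
  have bernoulli := one_add_mul_le_pow (a := -Q i) (by linarith [(hQ i).2]) m
  rw [← sub_eq_add_neg] at bernoulli
  exact mul_le_mul_of_nonneg_left (by linarith) (hW i)

theorem hitProb_mul_entropy_le (hW : ∀ i, 0 ≤ W i) (hQ : ∀ i, Q i ∈ Set.Icc 0 1)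
    (hρ : ∑ i, W i * Q i = ρ) (hρ0 : 0 < ρ) (hm : m ≠ 0) :
    hitProb W Q m * (-log (hitProb W Q m) + m * log 2 + 1) ≤
      (-log ρ + 1) * hitProb W Q m + ρ * log 2 * (m : ℝ) ^ 2 := by
  have hρu : ρ ≤ hitProb W Q m := hρ ▸ le_hitProb hW hQ hm
  have huρ : hitProb W Q m ≤ m * ρ := hρ ▸ hitProb_le hW hQ
  have hu0 := hρ0.trans_le hρu
  have log_le : log ρ ≤ log (hitProb W Q m) := Real.log_le_log hρ0 hρu
  have : 0 ≤ log 2 := Real.log_nonneg one_le_two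
  calc _ = hitProb W Q m * (-log (hitProb W Q m) + 1) + hitProb W Q m * (m * log 2) := by ring
    _ ≤ hitProb W Q m * (-log ρ + 1) + m * ρ * (m * log 2) := by gcongr
    _ = _ := by ring

/-- The inequalities between meeting probabilities and entropies, averaged over a geometric number
`m` of copies. -/
theorem mul_sum_saturate_le (hW : ∀ i, 0 ≤ W i) (hQ : ∀ i, Q i ∈ Set.Icc 0 1)
    (hρ : ∑ i, W i * Q i = ρ) (hρ0 : 0 < ρ) (hδ : 0 < δ)
    (hD : ∀ m, 0 < hitProb W Q m → D * meetProb W Q m ≤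
      2 * (hitProb W Q m * (-log (hitProb W Q m) + m * log 2 + 1))) :
    D * ∑ i, ∑ j, W i * W j * saturate δ (Q i * Q j) ≤
      2 * ((-log ρ + 1) * ∑ i, W i * saturate δ (Q i) + ρ * log 2 * geometricSecondMoment δ) := by
  have hQQ (i j : ι) : Q i * Q j ∈ Set.Icc (0 : ℝ) 1 :=
    ⟨mul_nonneg (hQ i).1 (hQ j).1, mul_le_one₀ (hQ i).2 (hQ j).1 (hQ j).2⟩
  have hasSum_meet : HasSum (fun m => D * (δ / (1 + δ) ^ m * meetProb W Q m))
      (D * ∑ i, ∑ j, W i * W j * saturate δ (Q i * Q j)) := by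
    simp only [meetProb, Finset.mul_sum, mul_left_comm (δ / _)]
    exact hasSum_sum fun i _ => hasSum_sum fun j _ =>
      ((hasSum_saturate hδ (hQQ i j)).mul_left _).mul_left D
  have hasSum_hit : HasSum (fun m => δ / (1 + δ) ^ m * hitProb W Q m)
      (∑ i, W i * saturate δ (Q i)) := by
    simp only [hitProb, Finset.mul_sum, mul_left_comm (δ / _)]
    exact hasSum_sum fun i _ => (hasSum_saturate hδ (hQ i)).mul_left _
  refine hasSum_le (fun m => ?_) hasSum_meet (((hasSum_hit.mul_left (-log ρ + 1)).add
    ((hasSum_geometricSecondMoment hδ).mul_left (ρ * log 2))).mul_left 2)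
  rcases eq_or_ne m 0 with rfl | hm
  · simp [meetProb, hitProb]
  have entropy_le := hitProb_mul_entropy_le hW hQ hρ hρ0 hm
  have meet_le := hD m (hρ0.trans_le (hρ ▸ le_hitProb hW hQ hm))
  have weighted := mul_le_mul_of_nonneg_left (meet_le.trans
    (mul_le_mul_of_nonneg_left entropy_le zero_le_two)) (by positivity : 0 ≤ δ / (1 + δ) ^ m)
  linarith

theorem le_sum_saturate_mul (hW : ∀ i, 0 ≤ W i) (hQ : ∀ i, Q i ∈ Set.Icc 0 1) (hδ : 0 < δ)
    {G : ℝ} (hρ : ∑ i, W i * Q i = ρ) (hG : ∑ i, W i * saturate δ (Q i) = G) :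
    (1 + δ) * (2 * ρ * G - ρ ^ 2) - δ * G ^ 2 ≤
      ∑ i, ∑ j, W i * W j * saturate δ (Q i * Q j) := by
  have sum_prod (f g : ι → ℝ) :
      ∑ i, ∑ j, W i * W j * (f i * g j) = (∑ i, W i * f i) * ∑ j, W j * g j := by
    simp only [Fintype.sum_mul_sum, mul_mul_mul_comm]
  calc (1 + δ) * (2 * ρ * G - ρ ^ 2) - δ * G ^ 2
      = ∑ i, ∑ j, W i * W j * ((1 + δ) * (Q i * saturate δ (Q j) + saturate δ (Q i) * Q j -
          Q i * Q j) - δ * (saturate δ (Q i) * saturate δ (Q j))) := by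
        simp only [mul_sub, mul_add, Finset.sum_sub_distrib, Finset.sum_add_distrib,
          mul_left_comm _ (1 + δ), mul_left_comm _ δ, ← Finset.mul_sum, sum_prod, hρ, hG]
        ring
    _ ≤ _ := Finset.sum_le_sum fun i _ => Finset.sum_le_sum fun j _ =>
        mul_le_mul_of_nonneg_left (le_saturate_mul hδ (hQ i) (hQ j)) (mul_nonneg (hW i) (hW j))

theorem mul_density_le (hW : ∀ i, 0 ≤ W i) (hQ : ∀ i, Q i ∈ Set.Icc 0 1)
    (hρ : ∑ i, W i * Q i = ρ) (hρ0 : 0 < ρ) (hD0 : 0 ≤ D) {M : ℝ} (hM : 1 < M)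
    (hMρ : ∑ i, W i * saturate (1 / M ^ 2) (Q i) = M * ρ)
    (hD : ∀ m, 0 < hitProb W Q m → D * meetProb W Q m ≤
      2 * (hitProb W Q m * (-log (hitProb W Q m) + m * log 2 + 1))) :
    D * ρ * (1 - 1 / M) ≤ -log ρ + (1 + log 2 * geometricSecondMoment (1 / M ^ 2)) := by
  have : 0 < M := one_pos.trans hM
  have hδ : 0 < 1 / M ^ 2 := by positivity
  have upper := mul_sum_saturate_le hW hQ hρ hρ0 hδ hD
  have lower := le_sum_saturate_mul hW hQ hδ hρ hMρ
  rw [hMρ] at upper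
  have moment_nonneg : 0 ≤ log 2 * geometricSecondMoment (1 / M ^ 2) :=
    mul_nonneg (Real.log_nonneg one_le_two) (geometricSecondMoment_nonneg hδ)
  have two_mul_le : ρ ^ 2 * (2 * M - 2) ≤
      ∑ i, ∑ j, W i * W j * saturate (1 / M ^ 2) (Q i * Q j) := by
    refine le_trans ?_ lower
    have : (1 + 1 / M ^ 2) * (2 * ρ * (M * ρ) - ρ ^ 2) - 1 / M ^ 2 * (M * ρ) ^ 2 -
        ρ ^ 2 * (2 * M - 2) = ρ ^ 2 / M ^ 2 * (2 * M - 1) := by field_simp; ring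
    have : 0 ≤ ρ ^ 2 / M ^ 2 * (2 * M - 1) := mul_nonneg (by positivity) (by linarith)
    linarith
  refine le_of_mul_le_mul_left (a := 2 * M * ρ) ?_ (by positivity)
  calc 2 * M * ρ * (D * ρ * (1 - 1 / M)) = D * (ρ ^ 2 * (2 * M - 2)) := by field_simp
    _ ≤ 2 * ((-log ρ + 1) * (M * ρ) + ρ * log 2 * geometricSecondMoment (1 / M ^ 2)) :=
        (mul_le_mul_of_nonneg_left two_mul_le hD0).trans upper
    _ = 2 * ρ * (M * (-log ρ + 1) + 1 * (log 2 * geometricSecondMoment (1 / M ^ 2))) := by ring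
    _ ≤ 2 * ρ * (M * (-log ρ + 1) + M * (log 2 * geometricSecondMoment (1 / M ^ 2))) := by gcongr
    _ = 2 * M * ρ * (-log ρ + (1 + log 2 * geometricSecondMoment (1 / M ^ 2))) := by ring

end Averaging

section LocalRules

open Real (log)

/-- The resampling probability at which the averaged `saturate` is `M` times the density. -/
theorem exists_sum_saturate_eq {Λ V : Type*} [Fintype Λ] [Fintype V] [DecidableEq V]
    {w : Λ → ℝ} (hw : w ∈ stdSimplex ℝ Λ) {ρ : ℝ} (G : (V → Λ) → Bool)
    (hρ : law w G true = ρ) (hρ0 : 0 < ρ) {M : ℝ} (hM : 1 < M)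
    (hρM : ρ ≤ 1 / M - 1 / M ^ 2) :
    ∃ p ∈ Set.Icc (0 : ℝ) 1,
      piExpect (baseWeight w p) (fun ω => saturate (1 / M ^ 2) (condProb w G ω)) = M * ρ := by
  have hM0 : 0 < M := one_pos.trans hM
  have at_zero :
      piExpect (baseWeight w 0) (fun ω => saturate (1 / M ^ 2) (condProb w G ω)) = ρ := by
    have saturate_indicator (b : Bool) :
        saturate (1 / M ^ 2) (if b = true then 1 else 0) = if b = true then 1 else 0 := by
      cases b <;> simp only [saturate, if_true, Bool.false_eq_true, if_false, mul_zero, zero_div]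
      rw [mul_one]
      exact div_self (by positivity)
    rw [piExpect_baseWeight_zero hw.2, ← hρ]
    simp only [saturate_indicator, law]
  have at_one : M * ρ ≤
      piExpect (baseWeight w 1) (fun ω => saturate (1 / M ^ 2) (condProb w G ω)) := by
    rw [piExpect_baseWeight_one hw.2, hρ, saturate, le_div_iff₀ (by positivity)]
    have : M * (ρ + 1 / M ^ 2) ≤ 1 :=
      calc M * (ρ + 1 / M ^ 2) ≤ M * (1 / M - 1 / M ^ 2 + 1 / M ^ 2) := by gcongr
        _ = 1 := by field_simp; ring
    nlinarith [div_pos one_pos (pow_pos hM0 2)]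
  exact intermediate_value_Icc zero_le_one (continuous_piExpect_baseWeight w _).continuousOn
    ⟨by rw [at_zero]; nlinarith, at_one⟩

variable {d R : ℕ} {Λ : Type*} [Fintype Λ] [Inhabited Λ] {w : Λ → ℝ}
  {F : (TreeVertex d → Λ) → Bool}

/-- The conflict inequality for `m` copies that share the labels which are not resampled. -/
theorem degree_mul_meetProb_le (hw : w ∈ stdSimplex ℝ Λ) (hF : DependsOn F (wordBall d R))
    (hind : ∀ x j, ¬ (F x = true ∧ F (fun v => x (endMulIso j v)) = true)) {p : ℝ}
    (hp : p ∈ Set.Icc 0 1) {m : ℕ} {W Q : (wordBall d R → Bool × Λ) → ℝ}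
    (hW : W = piWeight (baseWeight w p)) (hQ : Q = condProb w fun z => F (extendBall z))
    (hu : 0 < hitProb W Q m) :
    d * meetProb W Q m ≤ 2 * (hitProb W Q m * (-log (hitProb W Q m) + m * log 2 + 1)) := by
  have copies_dependsOn : DependsOn (copies F m) (wordBall d R) := fun x y hxy =>
    funext fun i => hF fun v hv => by simp only [hxy v hv]
  have ruleLaw_copies : ruleLaw (copyWeight w p m) R (copies F m) =
      fun σ => ∑ ω, W ω * piWeight (coinWeight (Q ω)) σ := by
    rw [hW, hQ, ← law_copies hw.2, ruleLaw]
    congr 1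
    funext z i
    refine hF fun v hv => ?_
    lift v to wordBall d R using hv
    simp only [extendBall, Subtype.val_injective.extend_apply]
  have copyWeight_mem : copyWeight w p m ∈ stdSimplex ℝ ((Bool × Λ) × (Fin m → Λ)) :=
    prodWeight_mem_stdSimplex (baseWeight_mem_stdSimplex hw hp) (piWeight_mem_stdSimplex hw)
  have conflict := degree_mul_conflictProb_le copyWeight_mem copies_dependsOn
    (K := fun σ τ => ∃ i, σ i = true ∧ τ i = true)
    fun x j ⟨i, hi⟩ => hind (fun v => mixLabel (x v).1 ((x v).2 i)) j hi
  have copies_law : ruleLaw (copyWeight w p m) R (copies F m) ∈ stdSimplex ℝ (Fin m → Bool) :=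
    law_mem_stdSimplex copyWeight_mem _
  have sum_W : ∑ ω, W ω = 1 := hW ▸ sum_piWeight (baseWeight_mem_stdSimplex hw hp).2
  have no_hit : 1 - ruleLaw (copyWeight w p m) R (copies F m) (fun _ => false) =
      hitProb W Q m := by
    simp [ruleLaw_copies, hitProb, mul_sub, sum_W, piWeight, coinWeight]
  have entropy_le := shannonEntropy_le_of_atom copies_law no_hit hu
  rw [ruleLaw_copies, conflictProb_mixture] at conflict
  simp only [conflictProb_piWeight_coinWeight] at conflict
  rw [Fintype.card_fun, Fintype.card_bool, Fintype.card_fin, Nat.cast_pow, Real.log_pow,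
    Nat.cast_two, ruleLaw_copies] at entropy_le
  exact conflict.trans (mul_le_mul_of_nonneg_left entropy_le zero_le_two)

theorem degree_mul_ruleLaw_le (hw : w ∈ stdSimplex ℝ Λ) (hF : DependsOn F (wordBall d R))
    (hind : ∀ x j, ¬ (F x = true ∧ F (fun v => x (endMulIso j v)) = true)) {ρ : ℝ}
    (hρ : ruleLaw w R F true = ρ) (hρ0 : 0 < ρ) : d * ρ ≤ 2 * (-log ρ + 2) := by
  have sum_Q : piExpect (baseWeight w 0)
      (condProb w fun z : wordBall d R → Λ => F (extendBall z)) = ρ :=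
    (piExpect_condProb hw.2 _ 0).trans hρ
  have hit_eq : hitProb (piWeight (baseWeight w 0))
      (condProb w fun z : wordBall d R → Λ => F (extendBall z)) 1 = ρ := by
    simp only [hitProb, pow_one, sub_sub_cancel]
    exact sum_Q
  have meet_eq : meetProb (piWeight (baseWeight w 0))
      (condProb w fun z : wordBall d R → Λ => F (extendBall z)) 1 = ρ * ρ := by
    rw [← sum_Q]
    simp only [meetProb, piExpect, pow_one, sub_sub_cancel, Fintype.sum_mul_sum,
      mul_mul_mul_comm]
  have conflict := degree_mul_meetProb_le (m := 1) hw hF hind ⟨le_rfl, zero_le_one⟩ rfl rfl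
    (hit_eq.symm ▸ hρ0)
  rw [hit_eq, meet_eq, Nat.cast_one, one_mul] at conflict
  refine le_of_mul_le_mul_left (a := ρ) ?_ hρ0
  calc ρ * (d * ρ) = d * (ρ * ρ) := by ring
    _ ≤ 2 * (ρ * (-log ρ + log 2 + 1)) := conflict
    _ = ρ * (2 * (-log ρ + (log 2 + 1))) := by ring
    _ ≤ ρ * (2 * (-log ρ + 2)) := by gcongr; linarith [Real.log_two_lt_d9]

theorem degree_mul_ruleLaw_mul_le (hw : w ∈ stdSimplex ℝ Λ) (hF : DependsOn F (wordBall d R))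
    (hind : ∀ x j, ¬ (F x = true ∧ F (fun v => x (endMulIso j v)) = true)) {ρ : ℝ}
    (hρ : ruleLaw w R F true = ρ) (hρ0 : 0 < ρ) {M : ℝ} (hM : 1 < M)
    (hρM : ρ ≤ 1 / M - 1 / M ^ 2) :
    d * ρ * (1 - 1 / M) ≤ -log ρ + (1 + log 2 * geometricSecondMoment (1 / M ^ 2)) := by
  obtain ⟨p, hp, hMρ⟩ := exists_sum_saturate_eq hw _ hρ hρ0 hM hρM
  exact mul_density_le (piWeight_nonneg (baseWeight_mem_stdSimplex hw hp).1)
    (condProb_mem_Icc hw _) ((piExpect_condProb hw.2 _ p).trans hρ) hρ0 (Nat.cast_nonneg d) hM hMρ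
    fun m => degree_mul_meetProb_le hw hF hind hp rfl rfl

theorem mul_le_one_add_mul_log {ε M C D ρ : ℝ} (hε : 0 < ε) (hM : 1 < M)
    (slope : (1 + ε) * (1 - 1 / M) = 1 + ε / 2) (hD : 0 < D) (hlog : 1 ≤ log D)
    (hC : 2 * C < log D * ε) (hρ : 0 < ρ) (refined : D * ρ * (1 - 1 / M) ≤ -log ρ + C) :
    D * ρ ≤ (1 + ε) * log D := by
  by_contra! hlt
  have neg_log_le : -log ρ ≤ log D := by
    have := Real.log_nonneg (show 1 ≤ D * ρ by nlinarith)
    rw [Real.log_mul hD.ne' hρ.ne'] at this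
    linarith
  have := mul_le_mul_of_nonneg_right hlt.le
    (sub_nonneg.2 ((div_le_one (one_pos.trans hM)).2 hM.le))
  rw [mul_right_comm, slope] at this
  linarith

theorem exists_ruleLaw_bound {ε : ℝ} (hε : 0 < ε) : ∃ D : ℕ, ∀ d : ℕ, D < d →
    ∀ (Λ : Type) [Fintype Λ] [Inhabited Λ] (w : Λ → ℝ), w ∈ stdSimplex ℝ Λ →
    ∀ (R : ℕ) (F : (TreeVertex d → Λ) → Bool), DependsOn F (wordBall d R) →
    (∀ x j, ¬ (F x = true ∧ F (fun v => x (endMulIso j v)) = true)) →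
    ruleLaw w R F true ≤ (1 + ε) * (log d / d) := by
  obtain ⟨M, hM⟩ : ∃ M, M = 2 * (1 + ε) / ε := ⟨_, rfl⟩
  have hM1 : 1 < M := by rw [hM, lt_div_iff₀ hε]; linarith
  have slope : (1 + ε) * (1 - 1 / M) = 1 + ε / 2 := by rw [hM]; field_simp; ring
  obtain ⟨s, hs⟩ : ∃ s, s = 1 / M - 1 / M ^ 2 := ⟨_, rfl⟩
  have hs0 : 0 < s :=
    hs ▸ sub_pos.2 (one_div_lt_one_div_of_lt (one_pos.trans hM1) (by nlinarith))
  have cast_tendsto : Tendsto (fun d : ℕ => (d : ℝ)) atTop atTop := tendsto_natCast_atTop_atTop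
  have log_tendsto := Real.tendsto_log_atTop.comp cast_tendsto
  obtain ⟨D, hD⟩ := eventually_atTop.1 ((log_tendsto.eventually_gt_atTop
    (2 * (1 + log 2 * geometricSecondMoment (1 / M ^ 2)) / ε)).and
    ((log_tendsto.eventually_ge_atTop 1).and
      (cast_tendsto.eventually_gt_atTop (2 * (-log s + 2) / s))))
  refine ⟨D, fun d hd Λ _ _ w hw R F hF hind => ?_⟩
  obtain ⟨hd_const, hd_log, hd_crude⟩ := hD d hd.le
  have hd0 : (0 : ℝ) < d := Nat.cast_pos.2 (Nat.zero_lt_of_lt hd)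
  obtain ⟨ρ, hρ⟩ : ∃ ρ, ruleLaw w R F true = ρ := ⟨_, rfl⟩
  rw [hρ, ← mul_div_assoc, le_div_iff₀ hd0, mul_comm]
  obtain hρ_le | hρ0 := le_or_gt ρ 0
  · have : 1 ≤ log d := hd_log
    nlinarith
  have small : ρ ≤ s := by
    by_contra! hgt
    have crude := degree_mul_ruleLaw_le hw hF hind hρ hρ0
    have := Real.log_le_log hs0 hgt.le
    have := mul_le_mul_of_nonneg_left hgt.le hd0.le
    rw [div_lt_iff₀ hs0] at hd_crude
    linarith
  exact mul_le_one_add_mul_log hε hM1 slope hd0 hd_log ((div_lt_iff₀ hε).1 hd_const) hρ0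
    (degree_mul_ruleLaw_mul_le hw hF hind hρ hρ0 hM1 (hs ▸ small))

end LocalRules

section Approximation

open scoped symmDiff

instance (d : ℕ) : IsProbabilityMeasure (labelMeasure d) :=
  inferInstanceAs (IsProbabilityMeasure (Measure.infinitePi _))

variable {d R : ℕ} {Λ : Type*} {q : unitInterval → Λ}

/-- The law on `Λ` of a uniform label quantized by `q`. -/
noncomputable def quantizedLaw (q : unitInterval → Λ) (t : Λ) : ℝ :=
  (volume : Measure unitInterval).real (q ⁻¹' {t})

theorem sum_measureReal_fiber {Ω ι : Type*} [MeasurableSpace Ω] (μ : Measure Ω)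
    [IsFiniteMeasure μ] {Y : Ω → ι} (hY : ∀ i, MeasurableSet (Y ⁻¹' {i})) (s : Finset ι) :
    ∑ i ∈ s, μ.real (Y ⁻¹' {i}) = μ.real (Y ⁻¹' s) := by
  simp only [measureReal_def]
  rw [← ENNReal.toReal_sum fun _ _ => measure_ne_top _ _,
    sum_measure_preimage_singleton s fun i _ => hY i]

theorem quantizedLaw_mem_stdSimplex [Fintype Λ] (hq : ∀ t, MeasurableSet (q ⁻¹' {t})) :
    quantizedLaw q ∈ stdSimplex ℝ Λ := by
  refine ⟨fun _ => measureReal_nonneg, ?_⟩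
  simp only [quantizedLaw]
  rw [sum_measureReal_fiber _ hq, Finset.coe_univ, Set.preimage_univ, probReal_univ]

theorem preimage_quantize_ball (z : wordBall d R → Λ) :
    (fun (x : TreeLabelling d) (v : wordBall d R) => q (x v)) ⁻¹' {z} =
      (fun x v => x v.1) ⁻¹' Set.univ.pi fun v => q ⁻¹' {z v} := by
  ext x
  simp [funext_iff]

theorem measurableSet_quantize_ball (hq : ∀ t, MeasurableSet (q ⁻¹' {t}))
    (z : wordBall d R → Λ) :
    MeasurableSet ((fun (x : TreeLabelling d) (v : wordBall d R) => q (x v)) ⁻¹' {z}) := by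
  rw [preimage_quantize_ball]
  exact (by fun_prop : Measurable fun (x : TreeLabelling d) (v : wordBall d R) => x v.1)
    (MeasurableSet.univ_pi fun v => hq _)

theorem measureReal_quantize_ball (hq : ∀ t, MeasurableSet (q ⁻¹' {t}))
    (z : wordBall d R → Λ) :
    (labelMeasure d).real ((fun x (v : wordBall d R) => q (x v)) ⁻¹' {z}) =
      piWeight (quantizedLaw q) z := by
  rw [preimage_quantize_ball, ← map_measureReal_apply (by fun_prop)
    (MeasurableSet.univ_pi fun v => hq _), labelMeasure,
    Measure.map_infinitePi_infinitePi_of_inj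
      (P := fun _ : TreeVertex d => (volume : Measure unitInterval)) Subtype.val_injective,
    Measure.infinitePi_eq_pi, measureReal_def, Measure.pi_pi, ENNReal.toReal_prod]
  rfl

theorem setOf_rule_eq_preimage [Fintype Λ] [Inhabited Λ] {F : (TreeVertex d → Λ) → Bool}
    (hF : DependsOn F (wordBall d R)) :
    {x : TreeLabelling d | F (q ∘ x) = true} = (fun x (v : wordBall d R) => q (x v)) ⁻¹'
      (Finset.univ.filter fun z : wordBall d R → Λ => F (extendBall z) = true) := by
  ext x
  have := hF (extendBall_restrict_eqOn (R := R) (q ∘ x))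
  simp only [Set.mem_ofPred_eq, ← this, Finset.coe_filter, Finset.mem_univ, true_and,
    Set.mem_preimage]
  rfl

theorem measurableSet_setOf_rule [Finite Λ] [Inhabited Λ]
    (hq : ∀ t, MeasurableSet (q ⁻¹' {t})) {F : (TreeVertex d → Λ) → Bool}
    (hF : DependsOn F (wordBall d R)) : MeasurableSet {x : TreeLabelling d | F (q ∘ x) = true} := by
  have := Fintype.ofFinite Λ
  rw [setOf_rule_eq_preimage hF, ← Set.biUnion_preimage_singleton]
  exact Finset.measurableSet_biUnion _ fun z _ => measurableSet_quantize_ball hq z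

theorem measureReal_setOf_rule [Fintype Λ] [Inhabited Λ] (hq : ∀ t, MeasurableSet (q ⁻¹' {t}))
    {F : (TreeVertex d → Λ) → Bool} (hF : DependsOn F (wordBall d R)) :
    (labelMeasure d).real {x | F (q ∘ x) = true} = ruleLaw (quantizedLaw q) R F true := by
  rw [setOf_rule_eq_preimage hF, ← sum_measureReal_fiber _ (measurableSet_quantize_ball hq),
    ruleLaw, law, piExpect, Finset.sum_filter]
  simp only [measureReal_quantize_ball hq, mul_ite, mul_one, mul_zero]

/-- A set of labellings is finitary if it is defined by a rule of finite radius for quantized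
labels.  The finitary sets form a ring that generates the measurable sets. -/
def IsFinitary (S : Set (TreeLabelling d)) : Prop :=
  ∃ (Λ : Type) (_ : Fintype Λ) (q : unitInterval → Λ) (R : ℕ) (F : (TreeVertex d → Λ) → Bool),
    (∀ t, MeasurableSet (q ⁻¹' {t})) ∧ DependsOn F (wordBall d R) ∧ S = {x | F (q ∘ x) = true}

theorem isFinitary_const (b : Bool) : IsFinitary {_x : TreeLabelling d | b = true} :=
  ⟨Unit, inferInstance, fun _ => (), 0, fun _ => b,
    fun _ => measurable_const (measurableSet_singleton _), fun _ _ _ => rfl, rfl⟩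

theorem IsFinitary.combine {S T : Set (TreeLabelling d)} (hS : IsFinitary S) (hT : IsFinitary T)
    {U : Set (TreeLabelling d)} (op : Bool → Bool → Bool)
    (hU : ∀ x (a b : Bool), (x ∈ S ↔ a = true) → (x ∈ T ↔ b = true) →
      (x ∈ U ↔ op a b = true)) : IsFinitary U := by
  obtain ⟨Λ, _, q, R, F, hq, hF, rfl⟩ := hS
  obtain ⟨Λ', _, q', R', F', hq', hF', rfl⟩ := hT
  refine ⟨Λ × Λ', inferInstance, fun t => (q t, q' t), max R R',
    fun z => op (F fun v => (z v).1) (F' fun v => (z v).2), fun t => ?_, fun x y hxy => ?_,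
    Set.ext fun x => hU x _ _ Iff.rfl Iff.rfl⟩
  · convert (hq t.1).inter (hq' t.2) using 1
    ext s
    simp [Prod.ext_iff]
  · exact congrArg₂ op
      (hF fun v hv => congrArg Prod.fst (hxy v (wordBall_mono (le_max_left R R') hv)))
      (hF' fun v hv => congrArg Prod.snd (hxy v (wordBall_mono (le_max_right R R') hv)))

theorem isSetRing_isFinitary (d : ℕ) : IsSetRing {S : Set (TreeLabelling d) | IsFinitary S} where
  empty_mem := by
    convert isFinitary_const (d := d) false using 1
    simp
  union_mem S T hS hT := hS.combine hT (· || ·) fun x a b ha hb => by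
    simp [Set.mem_union, ha, hb]
  sdiff_mem S T hS hT := hS.combine hT (fun a b => a && !b) fun x a b ha hb => by
    simp [Set.mem_sdiff, ha, hb]

theorem IsFinitary.measurableSet {S : Set (TreeLabelling d)} (hS : IsFinitary S) :
    MeasurableSet S := by
  obtain ⟨Λ, _, q, R, F, hq, hF, rfl⟩ := hS
  have : Inhabited Λ := ⟨q 0⟩
  exact measurableSet_setOf_rule hq hF

theorem generateFrom_isFinitary (d : ℕ) : (inferInstance : MeasurableSpace (TreeLabelling d)) =
    MeasurableSpace.generateFrom {S : Set (TreeLabelling d) | IsFinitary S} := by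
  classical
  refine le_antisymm (iSup_le ?_)
    (MeasurableSpace.generateFrom_le fun S hS => IsFinitary.measurableSet hS)
  rintro v _ ⟨A, hA, rfl⟩
  refine MeasurableSpace.measurableSet_generateFrom ⟨Bool, inferInstance, fun t => decide (t ∈ A),
    v.1.length, fun z => z v, fun t => ?_, fun x y hxy => hxy v (le_refl v.1.length), ?_⟩
  · cases t
    · convert hA.compl using 1
      ext s
      simp
    · convert hA using 1
      ext s
      simp
  · ext x
    simp

theorem exists_isFinitary_symmDiff_lt {A : Set (TreeLabelling d)} (hA : MeasurableSet A) {η : ℝ}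
    (hη : 0 < η) : ∃ S, IsFinitary S ∧ (labelMeasure d).real (S ∆ A) < η := by
  obtain ⟨S, hS, hSA⟩ := exists_measure_symmDiff_lt_of_generateFrom_isSetRing
    (μ := labelMeasure d) (isSetRing_isFinitary d) ⟨{Set.univ}, Set.countable_singleton _, by
      rintro _ rfl
      convert isFinitary_const (d := d) true using 1
      simp, by simp⟩ (generateFrom_isFinitary d) hA (ENNReal.ofReal_pos.2 hη)
  exact ⟨S, hS, ENNReal.toReal_lt_of_lt_ofReal hSA⟩

theorem measurePreserving_relabel (φ : regularTree d ≃g regularTree d) :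
    MeasurePreserving (relabel φ) (labelMeasure d) (labelMeasure d) :=
  ⟨measurable_pi_lambda _ fun _ => measurable_pi_apply _,
    Measure.map_infinitePi_infinitePi_of_inj
      (P := fun _ : TreeVertex d => (volume : Measure unitInterval)) φ.symm.injective⟩

theorem treeRoot_mem_factorProcess_iff {f : TreeLabelling d → Bool} (hf : IsFactor f)
    (x : TreeLabelling d) : treeRoot d ∈ factorProcess f x ↔ f x = true :=
  mem_factorProcess_iff hf x (RelIso.refl _) rfl

/-- If `x` is a labelling with an independent process, then the root and its neighbour `[j]` are
not both in the process. -/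
theorem eq_false_relabel_of_isIndepSet {f : TreeLabelling d → Bool} (hf : IsFactor f)
    {x : TreeLabelling d} (hx : (regularTree d).IsIndepSet (factorProcess f x))
    (hfx : f x = true) (j : Fin d) : f (relabel (endMulIso j) x) = false := by
  rw [Bool.eq_false_iff]
  intro hj
  let v : TreeVertex d := ⟨[j], List.isChain_singleton j⟩
  have adj : (regularTree d).Adj (treeRoot d) v := .inl ⟨j, rfl⟩
  have endMulIso_v : endMulIso j v = treeRoot d := Subtype.ext (endMul_concat j [])
  exact hx ((treeRoot_mem_factorProcess_iff hf x).2 hfx)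
    (⟨endMulIso j, endMulIso_v, hj⟩ : v ∈ factorProcess f x) adj.ne adj

/-- The rule that keeps the root only if `F` selects it and none of its neighbours. -/
def isolatedRule (F : (TreeVertex d → Λ) → Bool) (x : TreeVertex d → Λ) : Bool :=
  decide (F x = true ∧ ∀ j, F (fun v => x (endMulIso j v)) = false)

theorem isolatedRule_eq_true {F : (TreeVertex d → Λ) → Bool} {x : TreeVertex d → Λ} :
    isolatedRule F x = true ↔ F x = true ∧ ∀ j, F (fun v => x (endMulIso j v)) = false :=
  decide_eq_true_iff

theorem isolatedRule_dependsOn {F : (TreeVertex d → Λ) → Bool} (hF : DependsOn F (wordBall d R)) :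
    DependsOn (isolatedRule F) (wordBall d (R + 1)) := by
  intro x y hxy
  have root_eq : F x = F y := hF fun v hv => hxy v (wordBall_mono R.le_succ hv)
  have neighbour_eq (j : Fin d) : F (fun v => x (endMulIso j v)) = F (fun v => y (endMulIso j v)) :=
    hF fun v hv => hxy _ ((length_endMul_le j v.1).trans (Nat.succ_le_succ hv))
  simp only [isolatedRule, root_eq, neighbour_eq]

theorem isolatedRule_not_adjacent (F : (TreeVertex d → Λ) → Bool) (x : TreeVertex d → Λ)
    (j : Fin d) :
    ¬ (isolatedRule F x = true ∧ isolatedRule F (fun v => x (endMulIso j v)) = true) := by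
  rintro ⟨hx, hxj⟩
  rw [isolatedRule_eq_true] at hx hxj
  exact Bool.false_ne_true ((hx.2 j).symm.trans hxj.1)

/-- Isolating an approximation of an independent process costs at most one approximation error
for the root and one for each of its neighbours. -/
theorem measureReal_le_isolatedRule {f : TreeLabelling d → Bool} (hf : IsIndepSetFactor f)
    {F : (TreeVertex d → Λ) → Bool} (hF : MeasurableSet {x : TreeLabelling d | F (q ∘ x) = true}) :
    (labelMeasure d).real {x | f x = true} ≤
      (labelMeasure d).real {x | isolatedRule F (q ∘ x) = true} +
        (d + 1) * (labelMeasure d).real ({x | F (q ∘ x) = true} ∆ {x | f x = true}) := by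
  obtain ⟨E, hE⟩ : ∃ E, E = {x : TreeLabelling d | F (q ∘ x) = true} ∆ {x | f x = true} :=
    ⟨_, rfl⟩
  have E_measurable : MeasurableSet E :=
    hE ▸ hF.symmDiff (hf.isFactor.measurable (measurableSet_singleton true))
  have eq_of_notMem {x : TreeLabelling d} (hx : x ∉ E) : F (q ∘ x) = true ↔ f x = true := by
    rw [hE, Set.mem_symmDiff] at hx
    tauto
  have cover : {x | f x = true} ≤ᵐ[labelMeasure d] ({x | isolatedRule F (q ∘ x) = true} ∪ E ∪
      ⋃ j ∈ Finset.univ, relabel (endMulIso j) ⁻¹' E : Set (TreeLabelling d)) := by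
    filter_upwards [hf.indep] with x hx hfx
    by_cases hxE : x ∈ E
    · exact .inl (.inr hxE)
    by_cases hjE : ∃ j, relabel (endMulIso j) x ∈ E
    · obtain ⟨j, hj⟩ := hjE
      exact .inr (Set.mem_iUnion₂.2 ⟨j, Finset.mem_univ j, hj⟩)
    refine .inl (.inl (isolatedRule_eq_true.2 ⟨(eq_of_notMem hxE).2 hfx, fun j => ?_⟩))
    have := eq_false_relabel_of_isIndepSet hf.isFactor hx hfx j
    rw [Bool.eq_false_iff, Ne, ← eq_of_notMem fun hj => hjE ⟨j, hj⟩] at this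
    exact Bool.eq_false_iff.2 this
  have preimage_eq (j : Fin d) : (labelMeasure d).real (relabel (endMulIso j) ⁻¹' E) =
      (labelMeasure d).real E :=
    (measurePreserving_relabel _).measureReal_preimage E_measurable.nullMeasurableSet
  rw [← hE]
  calc (labelMeasure d).real {x | f x = true}
      ≤ _ := ENNReal.toReal_mono (measure_ne_top _ _) (measure_mono_ae cover)
    _ ≤ (labelMeasure d).real {x | isolatedRule F (q ∘ x) = true} + (labelMeasure d).real E +
          ∑ j : Fin d, (labelMeasure d).real (relabel (endMulIso j) ⁻¹' E) :=
        (measureReal_union_le _ _).trans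
          (add_le_add (measureReal_union_le _ _) (measureReal_biUnion_finset_le _ _))
    _ = _ := by
        simp only [preimage_eq, Finset.sum_const, Finset.card_univ, Fintype.card_fin,
          nsmul_eq_mul]
        ring

theorem exists_ruleLaw_gt {f : TreeLabelling d → Bool} (hf : IsIndepSetFactor f) {c : ℝ}
    (hc : c < factorDensity f) :
    ∃ (Λ : Type) (_ : Fintype Λ) (_ : Inhabited Λ) (w : Λ → ℝ) (R : ℕ)
      (F : (TreeVertex d → Λ) → Bool), w ∈ stdSimplex ℝ Λ ∧ DependsOn F (wordBall d R) ∧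
      (∀ x j, ¬ (F x = true ∧ F (fun v => x (endMulIso j v)) = true)) ∧ c < ruleLaw w R F true := by
  have density_eq : factorDensity f = (labelMeasure d).real {x | f x = true} := by
    simp only [factorDensity, treeRoot_mem_factorProcess_iff hf.isFactor]
  have degree_pos : (0 : ℝ) < d + 1 := by positivity
  obtain ⟨_, ⟨Λ, _, q, R, F, hq, hF, rfl⟩, hη⟩ := exists_isFinitary_symmDiff_lt
    (hf.isFactor.measurable (measurableSet_singleton true))
    (div_pos (sub_pos.2 hc) degree_pos)
  have : Inhabited Λ := ⟨q 0⟩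
  refine ⟨Λ, inferInstance, inferInstance, quantizedLaw q, R + 1, isolatedRule F,
    quantizedLaw_mem_stdSimplex hq, isolatedRule_dependsOn hF, isolatedRule_not_adjacent F, ?_⟩
  have le_isolated := measureReal_le_isolatedRule hf (measurableSet_setOf_rule hq hF)
  rw [← density_eq, measureReal_setOf_rule hq (isolatedRule_dependsOn hF)] at le_isolated
  rw [lt_div_iff₀' degree_pos] at hη
  change (d + 1) * (labelMeasure d).real ({x | F (q ∘ x) = true} ∆ {x | f x = true}) < _ at hη
  linarith

theorem exists_factorDensity_bound {ε : ℝ} (hε : 0 < ε) : ∃ D : ℕ, ∀ d : ℕ, D < d →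
    ∀ f : TreeLabelling d → Bool, IsIndepSetFactor f →
      factorDensity f ≤ (1 + ε) * (Real.log d / d) := by
  obtain ⟨D, hD⟩ := exists_ruleLaw_bound hε
  refine ⟨D, fun d hd f hf => ?_⟩
  by_contra! h
  obtain ⟨Λ, _, _, w, R, F, hw, hF, hind, hlt⟩ := exists_ruleLaw_gt hf h
  exact (hD d hd Λ w hw R F hF hind).not_gt hlt

end Approximation

section Greedy

variable {d : ℕ}

/-- The approximations to the greedy independent set that lets the vertices join in the order of
their labels. -/
def greedySet : ℕ → TreeLabelling d → Set (TreeVertex d)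
  | 0, _ => ∅
  | n + 1, x => {v | ∀ u, (regularTree d).Adj v u → x u ≤ x v → u ∉ greedySet n x}

theorem mem_greedySet_succ {n : ℕ} {x : TreeLabelling d} {v : TreeVertex d} :
    v ∈ greedySet (n + 1) x ↔
      ∀ u, (regularTree d).Adj v u → x u ≤ x v → u ∉ greedySet n x := Iff.rfl

theorem map_mem_greedySet_relabel (φ : regularTree d ≃g regularTree d) (n : ℕ)
    (x : TreeLabelling d) (v : TreeVertex d) :
    φ v ∈ greedySet n (relabel φ x) ↔ v ∈ greedySet n x := by
  induction n generalizing v with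
  | zero => rfl
  | succ n ih =>
    rw [mem_greedySet_succ, mem_greedySet_succ, φ.surjective.forall]
    simp only [relabel, RelIso.symm_apply_apply, φ.map_adj_iff]
    exact forall₃_congr fun u _ _ => not_congr (ih u)

-- The map `A ↦ {v | ∀ u, v ~ u → x u ≤ x v → u ∉ A}` is antitone, so its iterates on `∅`
-- alternate around its fixed point.
theorem greedySet_subset (x : TreeLabelling d) (m : ℕ) :
    greedySet (2 * m) x ⊆ greedySet (2 * m + 1) x ∧
      greedySet (2 * (m + 1)) x ⊆ greedySet (2 * m + 1) x := by
  induction m with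
  | zero => exact ⟨fun v hv => hv.elim, fun v _ u _ _ hu => hu.elim⟩
  | succ m ih =>
    have hsub : greedySet (2 * (m + 1)) x ⊆ greedySet (2 * (m + 1) + 1) x :=
      fun v hv u huv hx hu => hv u huv hx (ih.2 hu)
    exact ⟨hsub, fun v hv u huv hx hu => hv u huv hx (hsub hu)⟩

theorem isIndepSet_greedySet (x : TreeLabelling d) (m : ℕ) :
    (regularTree d).IsIndepSet (greedySet (2 * m) x) := by
  cases m with
  | zero => exact fun v hv => hv.elim
  | succ m =>
    intro u hu v hv _ huv
    rcases le_total (x u) (x v) with hle | hle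
    · exact hv u huv.symm hle ((greedySet_subset x m).2 hu)
    · exact hu v huv hle ((greedySet_subset x m).2 hv)

instance : Countable (TreeVertex d) := Subtype.countable

theorem measurableSet_mem_greedySet (n : ℕ) (v : TreeVertex d) :
    MeasurableSet {x : TreeLabelling d | v ∈ greedySet n x} := by
  induction n generalizing v with
  | zero => exact MeasurableSet.empty
  | succ n ih =>
    simp only [mem_greedySet_succ, Set.ofPred_forall]
    exact MeasurableSet.iInter fun u => MeasurableSet.iInter fun _ =>
      MeasurableSet.imp (measurableSet_le (measurable_pi_apply u) (measurable_pi_apply v))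
        (ih u).compl

open Classical in
/-- The factor that generates the greedy independent sets. -/
noncomputable def greedyFactor (m : ℕ) (x : TreeLabelling d) : Bool :=
  decide (treeRoot d ∈ greedySet (2 * m) x)

theorem greedyFactor_eq_true {m : ℕ} {x : TreeLabelling d} :
    greedyFactor m x = true ↔ treeRoot d ∈ greedySet (2 * m) x := by
  simp only [greedyFactor, decide_eq_true_eq]

theorem isFactor_greedyFactor (m : ℕ) : IsFactor (greedyFactor (d := d) m) where
  measurable := by
    refine measurable_to_bool ?_
    simpa only [Set.preimage, Set.mem_singleton_iff, greedyFactor_eq_true] using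
      measurableSet_mem_greedySet (2 * m) (treeRoot d)
  invariant φ hφ x := by
    rw [Bool.eq_iff_iff, greedyFactor_eq_true, greedyFactor_eq_true,
      ← map_mem_greedySet_relabel φ (2 * m) x, hφ]

theorem factorProcess_greedyFactor (m : ℕ) (x : TreeLabelling d) :
    factorProcess (greedyFactor m) x = greedySet (2 * m) x := by
  ext v
  obtain ⟨φ, hφ⟩ := exists_iso_root v
  rw [mem_factorProcess_iff (isFactor_greedyFactor m) x φ hφ, greedyFactor_eq_true, ← hφ,
    map_mem_greedySet_relabel]

theorem isIndepSetFactor_greedyFactor (m : ℕ) : IsIndepSetFactor (greedyFactor (d := d) m) where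
  isFactor := isFactor_greedyFactor m
  indep := ae_of_all _ fun x => by
    rw [factorProcess_greedyFactor]
    exact isIndepSet_greedySet x m

/-- The version of the greedy approximation in which a vertex looks at its children only. -/
def rootedGreedySet : ℕ → TreeLabelling d → Set (TreeVertex d)
  | 0, _ => ∅
  | n + 1, x => {v | ∀ u : TreeVertex d, (∃ a, u.1 = a :: v.1) → x u ≤ x v →
      u ∉ rootedGreedySet n x}

theorem mem_rootedGreedySet_succ {n : ℕ} {x : TreeLabelling d} {v : TreeVertex d} :
    v ∈ rootedGreedySet (n + 1) x ↔
      ∀ u : TreeVertex d, (∃ a, u.1 = a :: v.1) → x u ≤ x v → u ∉ rootedGreedySet n x := Iff.rfl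

theorem mem_greedySet_iff_rooted {x : TreeLabelling d} (hx : Function.Injective x) (n : ℕ)
    (v : TreeVertex d) (hv : ∀ u : TreeVertex d, (∃ a, v.1 = a :: u.1) → x v < x u) :
    v ∈ greedySet n x ↔ v ∈ rootedGreedySet n x := by
  induction n generalizing v with
  | zero => rfl
  | succ n ih =>
    rw [mem_greedySet_succ, mem_rootedGreedySet_succ]
    have child : ∀ u : TreeVertex d, (∃ a, u.1 = a :: v.1) → x u ≤ x v →
        (u ∈ greedySet n x ↔ u ∈ rootedGreedySet n x) := by
      rintro u ⟨a, ha⟩ hle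
      refine ih u ?_
      rintro u' ⟨b, hb⟩
      obtain rfl : u' = v := Subtype.ext (List.cons.inj (hb.symm.trans ha)).2
      refine lt_of_le_of_ne hle fun heq => ?_
      rw [hx heq] at ha
      exact List.cons_ne_self _ _ ha.symm
    constructor
    · intro h u hu hle
      rw [← child u hu hle]
      exact h u (Or.inl hu) hle
    · rintro h u (hu | hu) hle
      · rw [child u hu hle]
        exact h u hu hle
      · exact absurd (hv u hu) (not_lt.2 hle)

theorem ae_injective_infinitePi {ι Ω : Type*} [Countable ι] [MeasurableSpace Ω] [MeasurableEq Ω]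
    (μ : Measure Ω) [IsProbabilityMeasure μ] [NullSingletonClass μ] :
    ∀ᵐ x ∂(Measure.infinitePi fun _ : ι => μ), Function.Injective x := by
  have hne : ∀ i j : ι, i ≠ j → ∀ᵐ x ∂(Measure.infinitePi fun _ : ι => μ), x i ≠ x j := by
    intro i j hij
    have hdiag : ∀ᵐ p ∂(μ.prod μ), p.1 ≠ p.2 := by
      refine (Measure.ae_prod_iff_ae_ae measurableSet_diagonal.compl).2 ?_
      exact ae_of_all _ fun a => (measure_eq_zero_iff_ae_notMem.1 (measure_singleton a)).mono
        fun b hb hab => hb hab.symm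
    rw [← Measure.infinitePi_map_eval_prod (P := fun _ : ι => μ) hij] at hdiag
    exact ae_of_ae_map (f := fun x : ι → Ω => (x i, x j)) (by fun_prop) hdiag
  simp only [Function.Injective, ae_all_iff]
  intro i j
  by_cases hij : i = j
  · exact ae_of_all _ fun _ _ => hij
  · filter_upwards [hne i j hij] with x hx heq using absurd heq hx

theorem factorDensity_greedyFactor (m : ℕ) : factorDensity (greedyFactor (d := d) m) =
    (labelMeasure d).real {x | treeRoot d ∈ rootedGreedySet (2 * m) x} := by
  refine measureReal_congr ?_
  filter_upwards [ae_injective_infinitePi (ι := TreeVertex d) volume] with x hx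
  refine propext ?_
  change treeRoot d ∈ factorProcess (greedyFactor m) x ↔ _
  rw [factorProcess_greedyFactor]
  exact mem_greedySet_iff_rooted hx _ _ fun u ⟨_, ha⟩ => absurd ha (List.cons_ne_nil _ _).symm

end Greedy

section DisjointCoordinates

open ProbabilityTheory (iIndepFun IndepFun)

variable {ι V Ω β γ : Type*} [MeasurableSpace Ω] [MeasurableSpace β] [MeasurableSpace γ]

theorem iIndepFun_restrict_of_pairwise_disjoint (P : V → Measure Ω)
    [∀ v, IsProbabilityMeasure (P v)] {S : ι → Set V}
    (hS : Pairwise (Function.onFun Disjoint S)) :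
    iIndepFun (fun i => (S i).domRestrict) (Measure.infinitePi P) := by
  have hinj : Function.Injective fun p : (i : ι) × S i => p.2.1 := by
    rintro ⟨i, u, hu⟩ ⟨j, v, hv⟩ (rfl : u = v)
    obtain rfl : i = j := by
      by_contra hij
      exact Set.disjoint_left.1 (hS hij) hu hv
    rfl
  have hmeas : ∀ i, Measurable ((S i).domRestrict (π := fun _ => Ω)) := fun i =>
    measurable_pi_lambda _ fun u => measurable_pi_apply u.1
  rw [ProbabilityTheory.iIndepFun_iff_map_fun_eq_infinitePi_map hmeas]
  have hcurry := Measure.infinitePi_map_piCurry (κ := fun i => S i) (X := fun _ _ => Ω)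
    fun (i : ι) (u : S i) => P u
  change (Measure.infinitePi fun p : (i : ι) × S i => P p.2.1).map _ = _ at hcurry
  rw [← Measure.map_infinitePi_infinitePi_of_inj (P := P) hinj,
    Measure.map_map (by fun_prop) (by fun_prop)] at hcurry
  refine hcurry.trans (congrArg Measure.infinitePi (funext fun i => ?_))
  exact (Measure.map_infinitePi_infinitePi_of_inj (P := P) Subtype.val_injective).symm

theorem exists_measurable_comp_restrict [Nonempty Ω] {S : Set V} {X : (V → Ω) → β}
    (hX : Measurable X) (hXS : DependsOn X S) :
    ∃ g : (S → Ω) → β, Measurable g ∧ X = g ∘ S.domRestrict := by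
  classical
  let o : Ω := Classical.arbitrary Ω
  let extend (y : S → Ω) (v : V) : Ω := if h : v ∈ S then y ⟨v, h⟩ else o
  have hextend : Measurable extend := measurable_pi_lambda _ fun v => by
    by_cases h : v ∈ S
    · simpa only [extend, h, dif_pos] using measurable_pi_apply _
    · simpa only [extend, h, dif_neg, not_false_eq_true] using measurable_const
  refine ⟨X ∘ extend, hX.comp hextend, funext fun x => hXS fun v hv => ?_⟩
  simp only [extend, hv, dif_pos, Set.domRestrict_apply]

theorem iIndepFun_of_dependsOn [Nonempty Ω] (P : V → Measure Ω)
    [∀ v, IsProbabilityMeasure (P v)] {S : ι → Set V}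
    (hS : Pairwise (Function.onFun Disjoint S)) {X : ι → (V → Ω) → β}
    (hX : ∀ i, Measurable (X i)) (hXS : ∀ i, DependsOn (X i) (S i)) :
    iIndepFun X (Measure.infinitePi P) := by
  choose g hg hXg using fun i => exists_measurable_comp_restrict (hX i) (hXS i)
  rw [funext hXg]
  exact (iIndepFun_restrict_of_pairwise_disjoint P hS).comp g hg

theorem indepFun_of_dependsOn [Nonempty Ω] (P : V → Measure Ω)
    [∀ v, IsProbabilityMeasure (P v)] {S T : Set V} (hST : Disjoint S T) {X : (V → Ω) → β}
    {Y : (V → Ω) → γ} (hX : Measurable X) (hY : Measurable Y) (hXS : DependsOn X S)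
    (hYT : DependsOn Y T) : IndepFun X Y (Measure.infinitePi P) := by
  obtain ⟨g, hg, rfl⟩ := exists_measurable_comp_restrict hX hXS
  obtain ⟨h, hh, rfl⟩ := exists_measurable_comp_restrict hY hYT
  have hdisj : Pairwise (Function.onFun Disjoint fun b : Bool => cond b S T) := by
    rintro (_ | _) (_ | _) hab
    exacts [absurd rfl hab, hST.symm, hST, absurd rfl hab]
  exact ((iIndepFun_restrict_of_pairwise_disjoint P hdisj).indepFun
    (Bool.noConfusion : true ≠ false)).comp hg hh

end DisjointCoordinates

section Race

open ProbabilityTheory (iIndepFun IndepFun)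

theorem measureReal_prod_apply {α β : Type*} [MeasurableSpace α] [MeasurableSpace β]
    (μ : Measure α) (ν : Measure β) [SFinite μ] [IsFiniteMeasure ν] {M : Set (α × β)}
    (hM : MeasurableSet M) : (μ.prod ν).real M = ∫ a, ν.real (Prod.mk a ⁻¹' M) ∂μ := by
  rw [measureReal_def, Measure.prod_apply hM]
  exact (integral_toReal (measurable_measure_prodMk_left hM).aemeasurable
    (ae_of_all _ fun _ => measure_lt_top _ _)).symm

variable {Ω ι : Type*} [MeasurableSpace Ω] {μ : Measure Ω} [Fintype ι] {T : ι → Ω → ℝ}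

theorem measureReal_forall_lt (hT : iIndepFun T μ) (s : ℝ) :
    μ.real {ω | ∀ i, s < T i ω} = ∏ i, μ.real {ω | s < T i ω} := by
  have hinter : {ω | ∀ i, s < T i ω} = ⋂ i ∈ Finset.univ, T i ⁻¹' Set.Ioi s := by
    simp [Set.ext_iff]
  rw [hinter, measureReal_def,
    hT.measure_inter_preimage_eq_mul Finset.univ fun _ _ => measurableSet_Ioi, ENNReal.toReal_prod]
  rfl

theorem measureReal_le_and_forall_lt [IsProbabilityMeasure μ] {X : Ω → ℝ} (hXm : Measurable X)
    (hTm : ∀ i, Measurable (T i)) (hX : μ.map X = volume.restrict (Set.Icc 0 1))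
    (hT : iIndepFun T μ) (hXT : IndepFun X (fun ω i => T i ω) μ) {h : ℝ → ℝ}
    (hh : ∀ i, ∀ s ∈ Set.Icc (0 : ℝ) 1, μ.real {ω | s < T i ω} = h s) {t : ℝ}
    (ht : t ∈ Set.Icc (0 : ℝ) 1) :
    μ.real {ω | X ω ≤ t ∧ ∀ i, X ω < T i ω} = ∫ s in (0 : ℝ)..t, h s ^ Fintype.card ι := by
  have hTm' : Measurable fun ω i => T i ω := measurable_pi_lambda _ hTm
  let M : Set (ℝ × (ι → ℝ)) := {p | p.1 ≤ t ∧ ∀ i, p.1 < p.2 i}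
  have hM : MeasurableSet M := by
    simp only [M, Set.ofPred_and, Set.ofPred_forall]
    exact (measurableSet_le (by fun_prop) (by fun_prop)).inter
      (MeasurableSet.iInter fun i => measurableSet_lt (by fun_prop) (by fun_prop))
  have hsection : ∀ s ∈ Set.Icc (0 : ℝ) 1, (μ.map fun ω i => T i ω).real (Prod.mk s ⁻¹' M) =
      (Set.Icc 0 t).indicator (fun s => h s ^ Fintype.card ι) s := by
    intro s hs
    rw [map_measureReal_apply hTm' (measurable_prodMk_left hM)]
    by_cases hst : s ≤ t
    · rw [Set.indicator_of_mem (show s ∈ Set.Icc 0 t from ⟨hs.1, hst⟩)]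
      simp only [M, Set.preimage_ofPred_eq, hst, true_and]
      simp only [measureReal_forall_lt hT, hh _ s hs, Finset.prod_const, Finset.card_univ]
    · rw [Set.indicator_of_notMem fun hmem => hst hmem.2]
      simp [M, hst]
  calc μ.real {ω | X ω ≤ t ∧ ∀ i, X ω < T i ω}
      = (μ.map fun ω => (X ω, fun i => T i ω)).real M :=
        (map_measureReal_apply (hXm.prodMk hTm') hM).symm
    _ = ∫ s in Set.Icc 0 1, (μ.map fun ω i => T i ω).real (Prod.mk s ⁻¹' M) := by
        have := Measure.isProbabilityMeasure_map hTm'.aemeasurable (μ := μ)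
        rw [hXT.map_prod_eq_prod_map_map hXm.aemeasurable hTm'.aemeasurable, hX,
          measureReal_prod_apply _ _ hM]
    _ = ∫ s in Set.Icc 0 1 ∩ Set.Icc 0 t, h s ^ Fintype.card ι := by
        rw [setIntegral_congr_fun measurableSet_Icc hsection,
          setIntegral_indicator measurableSet_Icc]
    _ = ∫ s in (0 : ℝ)..t, h s ^ Fintype.card ι := by
        rw [Set.inter_eq_right.2 (Set.Icc_subset_Icc_right ht.2), integral_Icc_eq_integral_Ioc,
          intervalIntegral.integral_of_le ht.1]

end Race

section JoinTimes

variable {d : ℕ}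

theorem map_label (v : TreeVertex d) :
    (labelMeasure d).map (fun x => (x v : ℝ)) = volume.restrict (Set.Icc 0 1) := by
  have hlabel : (labelMeasure d).map (fun x => x v) = volume :=
    Measure.infinitePi_map_eval (fun _ : TreeVertex d => (volume : Measure unitInterval)) v
  change (labelMeasure d).map (Subtype.val ∘ fun x => x v) = _
  rw [← Measure.map_map measurable_subtype_coe (measurable_pi_apply v), hlabel]
  exact map_comap_subtype_coe measurableSet_Icc volume

open Classical in
/-- The label of a vertex that joins the rooted greedy set.  The value `2`, which exceeds every
label, stands for a vertex that never joins. -/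
noncomputable def joinTime (n : ℕ) (v : TreeVertex d) (x : TreeLabelling d) : ℝ :=
  if v ∈ rootedGreedySet n x then x v else 2

theorem lt_joinTime_iff {n : ℕ} {v : TreeVertex d} {x : TreeLabelling d} {s : ℝ} (hs : s ≤ 1) :
    s < joinTime n v x ↔ ¬ ((x v : ℝ) ≤ s ∧ v ∈ rootedGreedySet n x) := by
  unfold joinTime
  split_ifs with hv
  · rw [and_iff_left hv, not_le]
  · exact iff_of_true (by linarith) fun h => hv h.2

theorem measurableSet_mem_rootedGreedySet (n : ℕ) (v : TreeVertex d) :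
    MeasurableSet {x : TreeLabelling d | v ∈ rootedGreedySet n x} := by
  induction n generalizing v with
  | zero => exact MeasurableSet.empty
  | succ n ih =>
    simp only [mem_rootedGreedySet_succ, Set.ofPred_forall]
    exact MeasurableSet.iInter fun u => MeasurableSet.iInter fun _ =>
      MeasurableSet.imp (measurableSet_le (measurable_pi_apply u) (measurable_pi_apply v))
        (ih u).compl

theorem measurable_label (v : TreeVertex d) : Measurable fun x : TreeLabelling d => (x v : ℝ) :=
  measurable_subtype_coe.comp (measurable_pi_apply v)

theorem measurable_joinTime (n : ℕ) (v : TreeVertex d) : Measurable (joinTime n v) :=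
  Measurable.ite (measurableSet_mem_rootedGreedySet n v) (measurable_label v) measurable_const

/-- The vertices of the subtree of `𝕋_d` that hangs from `v`. -/
def descendants (v : TreeVertex d) : Set (TreeVertex d) := {u | v.1 <:+ u.1}

theorem self_mem_descendants (v : TreeVertex d) : v ∈ descendants v := List.suffix_refl _

theorem dependsOn_mem_rootedGreedySet (n : ℕ) (v : TreeVertex d) :
    DependsOn (fun x : TreeLabelling d => v ∈ rootedGreedySet n x) (descendants v) := by
  induction n generalizing v with
  | zero => exact fun _ _ _ => rfl
  | succ n ih =>
    intro x y hxy
    refine propext (forall₂_congr fun u ⟨a, hu⟩ => ?_)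
    have hsub : descendants u ⊆ descendants v := fun w hw =>
      (List.suffix_cons a v.1).trans (hu ▸ hw)
    rw [hxy v (self_mem_descendants v), hxy u (hsub (self_mem_descendants u))]
    exact imp_congr_right fun _ => not_congr (Iff.of_eq (ih u fun w hw => hxy w (hsub hw)))

theorem dependsOn_joinTime (n : ℕ) (v : TreeVertex d) :
    DependsOn (joinTime (d := d) n v) (descendants v) := by
  intro x y hxy
  classical
  simp only [joinTime, hxy v (self_mem_descendants v)]
  exact if_congr (Iff.of_eq (dependsOn_mem_rootedGreedySet n v hxy)) rfl rfl

/-- The letters that extend the word of a vertex. -/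
abbrev ChildLetter (v : TreeVertex d) : Type := {a : Fin d // (a :: v.1).IsChain (· ≠ ·)}

/-- The child of a vertex given by a letter. -/
def childVertex (v : TreeVertex d) (a : ChildLetter v) : TreeVertex d := ⟨a.1 :: v.1, a.2⟩

theorem notMem_descendants_childVertex (v : TreeVertex d) (a : ChildLetter v) :
    v ∉ descendants (childVertex v a) :=
  fun hv => absurd hv.length_le (Nat.not_succ_le_self _)

theorem pairwise_disjoint_descendants_childVertex (v : TreeVertex d) :
    Pairwise (Function.onFun Disjoint fun a => descendants (childVertex v a)) := by
  refine fun a b hab => Set.disjoint_left.2 fun u hua hub => hab (Subtype.ext ?_)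
  have hsuffix : (childVertex v a).1 <:+ (childVertex v b).1 :=
    List.suffix_of_suffix_length_le hua hub le_rfl
  exact (List.cons.inj (hsuffix.eq_of_length rfl)).1

theorem mem_rootedGreedySet_succ_iff_joinTime {n : ℕ} {x : TreeLabelling d} {v : TreeVertex d} :
    v ∈ rootedGreedySet (n + 1) x ↔ ∀ a, (x v : ℝ) < joinTime n (childVertex v a) x := by
  simp only [mem_rootedGreedySet_succ, lt_joinTime_iff (x v).2.2, not_and]
  constructor
  · exact fun h a => h (childVertex v a) ⟨a.1, rfl⟩
  · rintro h ⟨u, hu⟩ ⟨a, rfl⟩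
    exact h ⟨a, hu⟩

theorem iIndepFun_joinTime_childVertex (n : ℕ) (v : TreeVertex d) :
    ProbabilityTheory.iIndepFun (fun a => joinTime n (childVertex v a)) (labelMeasure d) :=
  iIndepFun_of_dependsOn (fun _ => volume) (pairwise_disjoint_descendants_childVertex v)
    (fun _ => measurable_joinTime n _) fun _ => dependsOn_joinTime n _

theorem indepFun_label_joinTime_childVertex (n : ℕ) (v : TreeVertex d) :
    ProbabilityTheory.IndepFun (fun x : TreeLabelling d => (x v : ℝ))
      (fun x a => joinTime n (childVertex v a) x) (labelMeasure d) := by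
  refine indepFun_of_dependsOn (fun _ => volume) (S := {v}) (T := {v}ᶜ) disjoint_compl_right
    (measurable_label v) (measurable_pi_lambda _ fun a => measurable_joinTime n _)
    (fun x y hxy => by simp only [hxy v rfl]) fun x y hxy => funext fun a => ?_
  exact dependsOn_joinTime n (childVertex v a) fun u hu =>
    hxy u fun huv => notMem_descendants_childVertex v a (huv ▸ hu)

theorem measureReal_mem_rootedGreedySet_succ (n : ℕ) (v : TreeVertex d) {g : ℝ → ℝ}
    (hg : ∀ a, ∀ s ∈ Set.Icc (0 : ℝ) 1, (labelMeasure d).real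
      {x | (x (childVertex v a) : ℝ) ≤ s ∧ childVertex v a ∈ rootedGreedySet n x} = g s)
    {t : ℝ} (ht : t ∈ Set.Icc (0 : ℝ) 1) :
    (labelMeasure d).real {x | (x v : ℝ) ≤ t ∧ v ∈ rootedGreedySet (n + 1) x} =
      ∫ s in (0 : ℝ)..t, (1 - g s) ^ Fintype.card (ChildLetter v) := by
  simp only [mem_rootedGreedySet_succ_iff_joinTime]
  refine measureReal_le_and_forall_lt (measurable_label v) (fun a => measurable_joinTime n _)
    (map_label v) (iIndepFun_joinTime_childVertex n v) (indepFun_label_joinTime_childVertex n v)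
    (fun a s hs => ?_) ht
  simp only [lt_joinTime_iff hs.2, ← hg a s hs]
  exact probReal_compl_eq_one_sub ((measurableSet_le (measurable_label _) measurable_const).inter
    (measurableSet_mem_rootedGreedySet n _))

end JoinTimes

section Recursion

/-- The iterates, started at `0`, of the integral equation `y t = ∫ s in 0..t, (1 - y s) ^ k`,
which is satisfied by the distribution function of the join times in a tree with `k` children per
vertex. -/
noncomputable def joinProb (k : ℕ) : ℕ → ℝ → ℝ
  | 0 => fun _ => 0
  | n + 1 => fun t => ∫ s in (0 : ℝ)..t, (1 - joinProb k n s) ^ k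

theorem continuous_joinProb (k n : ℕ) : Continuous (joinProb k n) := by
  induction n with
  | zero => exact continuous_const
  | succ n ih =>
    have hpow : Continuous fun s => (1 - joinProb k n s) ^ k := by fun_prop
    exact intervalIntegral.continuous_primitive (fun a b => hpow.intervalIntegrable a b) 0

theorem joinProb_mem_Icc (k n : ℕ) {t : ℝ} (ht : t ∈ Set.Icc (0 : ℝ) 1) :
    joinProb k n t ∈ Set.Icc (0 : ℝ) 1 := by
  induction n generalizing t with
  | zero => exact ⟨le_rfl, zero_le_one⟩
  | succ n ih =>
    have hmem : ∀ s ∈ Set.Icc 0 t, 1 - joinProb k n s ∈ Set.Icc (0 : ℝ) 1 := fun s hs =>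
      Set.Icc.mem_iff_one_sub_mem.1 (ih ⟨hs.1, hs.2.trans ht.2⟩)
    refine ⟨intervalIntegral.integral_nonneg ht.1 fun s hs => pow_nonneg (hmem s hs).1 _, ?_⟩
    have hpow : Continuous fun s => (1 - joinProb k n s) ^ k := by
      have := continuous_joinProb k n
      fun_prop
    calc joinProb k (n + 1) t
        ≤ ∫ _ in (0 : ℝ)..t, (1 : ℝ) := intervalIntegral.integral_mono_on ht.1
          (hpow.intervalIntegrable _ _) (continuous_const.intervalIntegrable _ _)
          fun s hs => pow_le_one₀ (hmem s hs).1 (hmem s hs).2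
      _ = t := by rw [integral_one, sub_zero]
      _ ≤ 1 := ht.2

/-- The solution `y` of `y' = -y ^ (κ + 1)`, `y 0 = 1`. -/
noncomputable def survival (κ t : ℝ) : ℝ := (1 + κ * t) ^ (-1 / κ)

variable {κ : ℝ}

theorem survival_mem_Icc (hκ : 0 < κ) {t : ℝ} (ht : 0 ≤ t) :
    survival κ t ∈ Set.Icc (0 : ℝ) 1 := by
  have hone : 1 ≤ 1 + κ * t := le_add_of_nonneg_right (mul_nonneg hκ.le ht)
  exact ⟨Real.rpow_nonneg (zero_le_one.trans hone) _, Real.rpow_le_one_of_one_le_of_nonpos hone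
    (div_nonpos_of_nonpos_of_nonneg (by norm_num) hκ.le)⟩

theorem continuousOn_survival (hκ : 0 < κ) : ContinuousOn (survival κ) (Set.Ici 0) := by
  refine ContinuousOn.rpow_const (by fun_prop) fun s hs => Or.inl ?_
  have := mul_nonneg hκ.le hs
  positivity

theorem intervalIntegrable_survival_pow (hκ : 0 < κ) (j : ℕ) {t : ℝ} (ht : 0 ≤ t) :
    IntervalIntegrable (fun s => survival κ s ^ j) volume 0 t := by
  refine (((continuousOn_survival hκ).pow j).mono ?_).intervalIntegrable
  rw [Set.uIcc_of_le ht]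
  exact fun s hs => hs.1

theorem integral_survival_pow (hκ : 0 < κ) {j : ℕ} {c : ℝ} (hc : 0 < c) (hj : (j : ℝ) = κ + c)
    {t : ℝ} (ht : 0 ≤ t) :
    ∫ s in (0 : ℝ)..t, survival κ s ^ j = (1 - (1 + κ * t) ^ (-c / κ)) / c := by
  rw [intervalIntegral.integral_eq_sub_of_hasDerivAt
    (f := fun s => -(1 + κ * s) ^ (-c / κ) / c) _ (intervalIntegrable_survival_pow hκ j ht)]
  · rw [mul_zero, add_zero, Real.one_rpow]
    ring
  intro s hs
  rw [Set.uIcc_of_le ht] at hs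
  have hpos : 0 < 1 + κ * s := by
    have := mul_nonneg hκ.le hs.1
    positivity
  have haffine : HasDerivAt (fun s => 1 + κ * s) κ s := by
    simpa using ((hasDerivAt_id s).const_mul κ).const_add 1
  have hexp : -1 / κ * j = -c / κ - 1 := by
    rw [hj]
    field_simp
    ring
  refine ((haffine.rpow_const (p := -c / κ) (Or.inl hpos.ne')).neg.div_const c).congr_deriv ?_
  rw [survival, ← Real.rpow_natCast, ← Real.rpow_mul hpos.le, hexp]
  field_simp

theorem abs_pow_sub_pow_le_mul {a b : ℝ} (ha : a ∈ Set.Icc (0 : ℝ) 1) (hb : b ∈ Set.Icc (0 : ℝ) 1)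
    (n : ℕ) : |a ^ n - b ^ n| ≤ n * |a - b| := by
  refine (abs_pow_sub_pow_le a b n).trans ?_
  rw [mul_comm |a - b|]
  refine mul_le_of_le_one_right (by positivity) (pow_le_one₀ (by positivity) ?_)
  rw [abs_of_nonneg ha.1, abs_of_nonneg hb.1]
  exact max_le ha.2 hb.2

theorem abs_integral_pow_sub_le (hκ : 0 < κ) (k n j : ℕ) {C t : ℝ} (ht : t ∈ Set.Icc (0 : ℝ) 1)
    (h : ∀ s ∈ Set.Icc 0 t, |1 - joinProb k n s - survival κ s| ≤ C * s ^ n) :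
    |(∫ s in (0 : ℝ)..t, (1 - joinProb k n s) ^ j) - ∫ s in (0 : ℝ)..t, survival κ s ^ j| ≤
      j * C * (t ^ (n + 1) / (n + 1)) := by
  have hjoin : IntervalIntegrable (fun s => (1 - joinProb k n s) ^ j) volume 0 t := by
    have := continuous_joinProb k n
    exact (by fun_prop : Continuous fun s => (1 - joinProb k n s) ^ j).intervalIntegrable _ _
  have hsurv := intervalIntegrable_survival_pow hκ j ht.1
  have hpow : Continuous fun s : ℝ => (j : ℝ) * C * s ^ n := by fun_prop
  have hbound : ∀ s ∈ Set.Icc 0 t,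
      |(1 - joinProb k n s) ^ j - survival κ s ^ j| ≤ j * C * s ^ n := by
    intro s hs
    refine (abs_pow_sub_pow_le_mul (Set.Icc.mem_iff_one_sub_mem.1
      (joinProb_mem_Icc k n ⟨hs.1, hs.2.trans ht.2⟩)) (survival_mem_Icc hκ hs.1) j).trans ?_
    rw [mul_assoc]
    exact mul_le_mul_of_nonneg_left (h s hs) (Nat.cast_nonneg _)
  rw [← intervalIntegral.integral_sub hjoin hsurv]
  calc |∫ s in (0 : ℝ)..t, ((1 - joinProb k n s) ^ j - survival κ s ^ j)|
      ≤ ∫ s in (0 : ℝ)..t, |(1 - joinProb k n s) ^ j - survival κ s ^ j| :=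
        intervalIntegral.abs_integral_le_integral_abs ht.1
    _ ≤ ∫ s in (0 : ℝ)..t, j * C * s ^ n := intervalIntegral.integral_mono_on ht.1
        (hjoin.sub hsurv).abs (hpow.intervalIntegrable _ _) hbound
    _ = j * C * (t ^ (n + 1) / (n + 1)) := by
        rw [intervalIntegral.integral_const_mul, integral_pow, zero_pow n.succ_ne_zero, sub_zero]

theorem abs_one_sub_joinProb_sub_le {k : ℕ} (hκ : 0 < κ) (hk : (k : ℝ) = κ + 1) (n : ℕ) {t : ℝ}
    (ht : t ∈ Set.Icc (0 : ℝ) 1) :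
    |1 - joinProb k n t - survival κ t| ≤ (k : ℝ) ^ n / n.factorial * t ^ n := by
  induction n generalizing t with
  | zero =>
    have hmem := survival_mem_Icc hκ ht.1
    simp only [joinProb, sub_zero, pow_zero, Nat.factorial_zero, Nat.cast_one, div_one, mul_one]
    rw [abs_of_nonneg (sub_nonneg.2 hmem.2)]
    exact sub_le_self _ hmem.1
  | succ n ih =>
    have hsurv : survival κ t = 1 - ∫ s in (0 : ℝ)..t, survival κ s ^ k := by
      rw [integral_survival_pow hκ one_pos hk ht.1, div_one, sub_sub_cancel, survival]
    rw [hsurv, sub_sub_sub_cancel_left, abs_sub_comm]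
    refine (abs_integral_pow_sub_le hκ k n k ht fun s hs =>
      ih ⟨hs.1, hs.2.trans ht.2⟩).trans_eq ?_
    rw [Nat.factorial_succ]
    push_cast
    field_simp
    ring

theorem tendsto_integral_joinProb {k d : ℕ} (hκ : 0 < κ) (hk : (k : ℝ) = κ + 1)
    (hd : (d : ℝ) = κ + 2) :
    Tendsto (fun n => ∫ s in (0 : ℝ)..1, (1 - joinProb k n s) ^ d) atTop
      (𝓝 ((1 - (1 + κ) ^ (-2 / κ)) / 2)) := by
  have hlim := integral_survival_pow hκ two_pos hd zero_le_one
  rw [mul_one] at hlim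
  have herror : Tendsto (fun n : ℕ => (d : ℝ) * ((k : ℝ) ^ n / n.factorial)) atTop (𝓝 0) := by
    simpa only [mul_zero] using
      (FloorSemiring.tendsto_pow_div_factorial_atTop (k : ℝ)).const_mul (d : ℝ)
  rw [← hlim, tendsto_iff_dist_tendsto_zero]
  refine squeeze_zero (fun _ => dist_nonneg) (fun n => ?_) herror
  rw [Real.dist_eq]
  refine (abs_integral_pow_sub_le hκ k n d (Set.right_mem_Icc.2 zero_le_one)
    fun s hs => abs_one_sub_joinProb_sub_le hκ hk n hs).trans ?_
  refine mul_le_of_le_one_right (by positivity) ?_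
  rw [one_pow, div_le_one (by positivity)]
  exact le_add_of_nonneg_left (Nat.cast_nonneg n)

end Recursion

section GreedyDensity

variable {d : ℕ}

theorem childVertex_ne_treeRoot (v : TreeVertex d) (a : ChildLetter v) :
    childVertex v a ≠ treeRoot d :=
  fun h => List.cons_ne_nil _ _ (congrArg Subtype.val h)

theorem card_childLetter_treeRoot : Fintype.card (ChildLetter (treeRoot d)) = d :=
  (Fintype.card_congr (Equiv.subtypeUnivEquiv fun a => List.isChain_singleton a)).trans
    (Fintype.card_fin d)

theorem card_childLetter_of_ne {v : TreeVertex d} (hv : v ≠ treeRoot d) :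
    Fintype.card (ChildLetter v) = d - 1 := by
  obtain ⟨_ | ⟨b, l⟩, hl⟩ := v
  · exact (hv rfl).elim
  · have hletter (a : Fin d) : (a :: b :: l).IsChain (· ≠ ·) ↔ ¬ a = b :=
      List.isChain_cons_cons.trans (and_iff_left hl)
    rw [Fintype.card_congr (Equiv.subtypeEquivRight hletter), Fintype.card_subtype_compl,
      Fintype.card_subtype_eq, Fintype.card_fin]

theorem measureReal_mem_rootedGreedySet (n : ℕ) {v : TreeVertex d} (hv : v ≠ treeRoot d) {t : ℝ}
    (ht : t ∈ Set.Icc (0 : ℝ) 1) :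
    (labelMeasure d).real {x | (x v : ℝ) ≤ t ∧ v ∈ rootedGreedySet n x} = joinProb (d - 1) n t := by
  induction n generalizing v t with
  | zero => simp [rootedGreedySet, joinProb]
  | succ n ih =>
    rw [measureReal_mem_rootedGreedySet_succ n v
      (fun a s hs => ih (childVertex_ne_treeRoot v a) hs) ht, card_childLetter_of_ne hv]
    rfl

theorem factorDensity_greedyFactor_succ (m : ℕ) :
    factorDensity (greedyFactor (d := d) (m + 1)) =
      ∫ s in (0 : ℝ)..1, (1 - joinProb (d - 1) (2 * m + 1) s) ^ d := by
  have hroot := measureReal_mem_rootedGreedySet_succ (2 * m + 1) (treeRoot d)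
    (fun a s hs => measureReal_mem_rootedGreedySet (2 * m + 1)
      (childVertex_ne_treeRoot (treeRoot d) a) hs) (Set.right_mem_Icc.2 zero_le_one)
  rw [card_childLetter_treeRoot] at hroot
  have hlabel (x : TreeLabelling d) : (x (treeRoot d) : ℝ) ≤ 1 := (x (treeRoot d)).2.2
  simp only [hlabel, true_and] at hroot
  rw [← hroot, factorDensity_greedyFactor]
  rfl

theorem bddAbove_factorDensity (d : ℕ) :
    BddAbove {ρ | ∃ f : TreeLabelling d → Bool, IsIndepSetFactor f ∧ ρ = factorDensity f} := by
  refine ⟨1, ?_⟩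
  rintro _ ⟨f, -, rfl⟩
  exact measureReal_le_one

theorem greedy_le_supIndepDensity (hd : 3 ≤ d) :
    (1 - ((d : ℝ) - 1) ^ (-2 / ((d : ℝ) - 2))) / 2 ≤ supIndepDensity d := by
  have hd' : (3 : ℝ) ≤ d := by exact_mod_cast hd
  have hlim := tendsto_integral_joinProb (k := d - 1) (d := d) (κ := (d : ℝ) - 2) (by linarith)
    (by rw [Nat.cast_sub (by omega)]; push_cast; ring) (by ring)
  rw [show 1 + ((d : ℝ) - 2) = d - 1 by ring] at hlim
  have hodd : Tendsto (fun m : ℕ => 2 * m + 1) atTop atTop :=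
    tendsto_atTop_mono (fun m => by simp only [id]; omega) tendsto_id
  refine le_of_tendsto' (hlim.comp hodd) fun m => le_csSup (bddAbove_factorDensity d) ?_
  exact ⟨greedyFactor (m + 1), isIndepSetFactor_greedyFactor _,
    (factorDensity_greedyFactor_succ m).symm⟩

end GreedyDensity

section Asymptotics

open Real (log)

theorem div_one_add_le_one_sub_exp_neg {y : ℝ} (hy : 0 ≤ y) : y / (1 + y) ≤ 1 - Real.exp (-y) := by
  have hexp : Real.exp (-y) ≤ 1 / (1 + y) := by
    rw [Real.exp_neg, ← one_div]
    exact one_div_le_one_div_of_le (by linarith) (by linarith [Real.add_one_le_exp y])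
  calc y / (1 + y) = 1 - 1 / (1 + y) := by field_simp; ring
    _ ≤ 1 - Real.exp (-y) := by linarith

theorem sub_one_rpow_le_exp {x : ℝ} (hx : 2 < x) :
    (x - 1) ^ (-2 / (x - 2)) ≤ Real.exp (-(2 * ((log x - log 2) / x))) := by
  have hlog : log x - log 2 ≤ log (x - 1) := by
    rw [← Real.log_div (by linarith) two_ne_zero]
    exact Real.log_le_log (by linarith) (by linarith)
  have hdiv : (log x - log 2) / x ≤ log (x - 1) / (x - 2) :=
    div_le_div₀ (Real.log_nonneg (by linarith)) hlog (by linarith) (by linarith)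
  rw [Real.rpow_def_of_pos (by linarith), Real.exp_le_exp]
  calc log (x - 1) * (-2 / (x - 2)) = -(2 * (log (x - 1) / (x - 2))) := by ring
    _ ≤ -(2 * ((log x - log 2) / x)) := by linarith

theorem le_treeAlpha {d : ℕ} (hd : 3 ≤ d) :
    (1 - log 2 / log d) / (1 + 2 * ((log d - log 2) / d)) ≤ treeAlpha d := by
  have hd' : (3 : ℝ) ≤ d := by exact_mod_cast hd
  have hlog : 0 < log d := Real.log_pos (by linarith)
  have hnonneg : 0 ≤ 2 * ((log d - log 2) / d) := by
    have := Real.log_le_log two_pos (by linarith : (2 : ℝ) ≤ d)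
    have := sub_nonneg.2 this
    positivity
  rw [treeAlpha, le_div_iff₀ (by positivity)]
  calc (1 - log 2 / log d) / (1 + 2 * ((log d - log 2) / d)) * (log d / d)
      = 2 * ((log d - log 2) / d) / (1 + 2 * ((log d - log 2) / d)) / 2 := by field_simp
    _ ≤ (1 - Real.exp (-(2 * ((log d - log 2) / d)))) / 2 := by
        gcongr
        exact div_one_add_le_one_sub_exp_neg hnonneg
    _ ≤ (1 - ((d : ℝ) - 1) ^ (-2 / ((d : ℝ) - 2))) / 2 := by
        gcongr
        exact sub_one_rpow_le_exp (by linarith)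
    _ ≤ supIndepDensity d := greedy_le_supIndepDensity hd

theorem treeAlpha_le {d : ℕ} (hd : 1 < d) {c : ℝ}
    (hc : ∀ f : TreeLabelling d → Bool, IsIndepSetFactor f → factorDensity f ≤ c * (log d / d)) :
    treeAlpha d ≤ c := by
  have hlog : 0 < log d := Real.log_pos (by exact_mod_cast hd)
  rw [treeAlpha, div_le_iff₀ (by positivity)]
  refine csSup_le ⟨_, greedyFactor 0, isIndepSetFactor_greedyFactor 0, rfl⟩ ?_
  rintro _ ⟨f, hf, rfl⟩
  exact hc f hf

theorem tendsto_treeAlpha : Tendsto treeAlpha atTop (𝓝 1) := by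
  have hlog : Tendsto (fun d : ℕ => log d) atTop atTop :=
    Real.tendsto_log_atTop.comp tendsto_natCast_atTop_atTop
  have hdiv : Tendsto (fun d : ℕ => (log d - log 2) / d) atTop (𝓝 0) := by
    simpa only [sub_div, sub_zero, Function.comp_def, id] using
      (Real.isLittleO_log_id_atTop.tendsto_div_nhds_zero.comp tendsto_natCast_atTop_atTop).sub
        (tendsto_const_div_atTop_nhds_zero_nat (log 2))
  refine tendsto_order.2 ⟨fun a ha => ?_, fun a ha => ?_⟩
  · have hlower : Tendsto
        (fun d : ℕ => (1 - log 2 / log d) / (1 + 2 * ((log d - log 2) / d))) atTop (𝓝 1) := by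
      simpa [Pi.div_def] using ((hlog.const_div_atTop (log 2)).const_sub 1).div
        ((hdiv.const_mul 2).const_add 1) (by norm_num)
    filter_upwards [hlower.eventually_const_lt ha, eventually_ge_atTop 3] with d had hd
    exact had.trans_le (le_treeAlpha hd)
  · obtain ⟨D, hD⟩ := exists_factorDensity_bound (ε := (a - 1) / 2) (by linarith)
    filter_upwards [eventually_gt_atTop D, eventually_gt_atTop 1] with d hDd hd
    exact (treeAlpha_le hd (hD d hDd)).trans_lt (by linarith)

end Asymptotics

theorem theorem2p1 :
    limsup (fun d : ℕ => (treeAlpha d : EReal)) atTop ≤ 1 ∧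
    (∀ ε : ℝ, 0 < ε → ∃ D : ℕ, ∀ d : ℕ, D < d →
      ∀ f : TreeLabelling d → Bool, IsIndepSetFactor f →
        factorDensity f ≤ (1 + ε) * (Real.log d / d)) ∧
    Tendsto treeAlpha atTop (𝓝 1) := by
  refine ⟨?_, fun ε hε => exists_factorDensity_bound hε, tendsto_treeAlpha⟩
  have hlim : Tendsto (fun d : ℕ => (treeAlpha d : EReal)) atTop (𝓝 1) :=
    (continuous_coe_real_ereal.tendsto 1).comp tendsto_treeAlpha
  exact hlim.limsup_eq.le
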